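/- **Theorem.** A run-length straight-line program (RLSLP) is a context-free grammar with linearly ordered variables, the greatest being the start variable, in which every variable has exactly one rule, of one of the forms $A\to a$ ($a$ a terminal), $A\to A_1A_2\cdots A_k$ ($k>1$), or $A\to B^t$ ($t>2$), the right-hand side using only variables smaller than $A$. These rules have size $1$, $k$ and $2$, respectively, and the size of the RLSLP is the sum of the sizes of its rules. For a nonempty string $w=w[1]\cdots w[n]$ let $g_{rl}$ be the size of the smallest RLSLP generating $w$. If the symbols of $w$ are natural numbers, define $$\begin{aligned} \mathrm{psv}(i)&=\max(\{j\mid j<i,\ w[j]<w[i]\}\cup\{0\}), & \mathrm{nsv}(i)&=\min(\{j\mid j>i,\ w[j]<w[i]\}\cup\{n+1\}),\\ \mathrm{psv}'(i,d)&=\max(\{j\mid j<i,\ w[j]<d\}\cup\{0\}), & \mathrm{nsv}'(i,d)&=\min(\{j\mid j>i,\ w[j]<d\}\cup\{n+1\}), \end{aligned}$$ where $j$ ranges over the positions $1,\dots,n$. There are a constant $C$ and four fixed word RAM programs such that the following holds for every nonempty string $w$ of length $n$ over the natural numbers and every word length $W$ (in bits) with $C(n+2)\le 2^W$ for which every symbol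 of $w$ is less than $2^W$. There is an index of at most $C\cdot g_{rl}$ words of $W$ bits (that is, of size $O(g_{rl})$) on which the four programs compute $\mathrm{psv}(i)$ and $\mathrm{nsv}(i)$ for all $1\le i\le n$, and $\mathrm{psv}'(i,d)$ and $\mathrm{nsv}'(i,d)$ for all $0\le i\le n+1$ and $0\le d<2^W$, each within $C(\lfloor\log_2 n\rfloor+1)$ steps (that is, in $O(\log n)$ time), using no memory besides the index and $O(1)$ registers, and leaving the index unchanged. -/

import Mathlib

namespace RunLength

/-! ### Run-length straight-line programs -/

/-- The right-hand side of a rule, over terminals `α` and variables `V`. -/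
inductive Rule (α V : Type) where
  | terminal (a : α)
  | concat (vars : List V) (hk : 1 < vars.length)
  | power (B : V) (t : ℕ) (ht : 2 < t)

/-- The size of a right-hand side: its length, where `B ^ t` counts as `2`. -/
def Rule.size {α V : Type} : Rule α V → ℕ
  | .terminal _ => 1
  | .concat vars _ => vars.length
  | .power _ _ _ => 2

/-- An RLSLP. The variables are `0, …, numVars - 1`, each with exactly one rule, whose right-hand
side only uses strictly smaller variables; the start variable is the greatest one. -/
structure RLSLP (α : Type) where
  numVars : ℕ
  numVars_pos : 0 < numVars
  rule : (A : Fin numVars) → Rule α (Fin A.val)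

namespace RLSLP

variable {α : Type}

/-- The string derived by the variable `A`. -/
def exp (G : RLSLP α) (A : ℕ) (hA : A < G.numVars) : List α :=
  match G.rule ⟨A, hA⟩ with
  | .terminal a => [a]
  | .concat vars _ => vars.flatMap fun B => G.exp B.val (B.isLt.trans hA)
  | .power B t _ => (List.replicate t (G.exp B.val (B.isLt.trans hA))).flatten
termination_by A
decreasing_by
  · exact B.isLt
  · exact B.isLt

/-- The string generated by the grammar. -/
def string (G : RLSLP α) : List α :=
  G.exp (G.numVars - 1) (Nat.sub_lt G.numVars_pos Nat.one_pos)

/-- The size of the grammar: the sum of the sizes of its right-hand sides. -/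
def size (G : RLSLP α) : ℕ :=
  ∑ A : Fin G.numVars, (G.rule A).size

end RLSLP

/-- `g_rl`: the size of the smallest RLSLP generating the (nonempty) string `w`. -/
noncomputable def gRL {α : Type} (w : List α) : ℕ :=
  sInf {s : ℕ | ∃ G : RLSLP α, G.string = w ∧ G.size = s}

/-! ### Previous and next smaller values

Positions in a string are numbered from `1` to `n`. -/

/-- The symbol at position `j` of `w`, where `1 ≤ j ≤ w.length`. -/
def symbol (w : List ℕ) (j : ℕ) : ℕ := w.getD (j - 1) 0

/-- `max ({j | j < i, w[j] < d} ∪ {0})` -/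
noncomputable def psvBelow (w : List ℕ) (i d : ℕ) : ℕ :=
  sSup ({j : ℕ | (1 ≤ j ∧ j ≤ w.length) ∧ j < i ∧ symbol w j < d} ∪ {0})

/-- `min ({j | j > i, w[j] < d} ∪ {n + 1})` -/
noncomputable def nsvBelow (w : List ℕ) (i d : ℕ) : ℕ :=
  sInf ({j : ℕ | (1 ≤ j ∧ j ≤ w.length) ∧ i < j ∧ symbol w j < d} ∪ {w.length + 1})

/-- `max ({j | j < i, w[j] < w[i]} ∪ {0})` -/
noncomputable def psv (w : List ℕ) (i : ℕ) : ℕ :=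
  sSup ({j : ℕ | (1 ≤ j ∧ j ≤ w.length) ∧ j < i ∧ symbol w j < symbol w i} ∪ {0})

/-- `min ({j | j > i, w[j] < w[i]} ∪ {n + 1})` -/
noncomputable def nsv (w : List ℕ) (i : ℕ) : ℕ :=
  sInf ({j : ℕ | (1 ≤ j ∧ j ≤ w.length) ∧ i < j ∧ symbol w j < symbol w i} ∪ {w.length + 1})

/-! ### A word RAM -/

/-- Instructions. Below, `R` are the registers and `M` is the memory; a program can only name
finitely many registers, and reaches the memory only through addresses held in registers. -/
inductive Instr where
  /-- `R[r] := k` -/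
  | const (r k : ℕ)
  /-- `R[r] := R[a]` -/
  | copy (r a : ℕ)
  /-- `R[r] := R[a] + R[b]` -/
  | add (r a b : ℕ)
  /-- `R[r] := max (R[a] - R[b], 0)` -/
  | sub (r a b : ℕ)
  /-- `R[r] := R[a] * R[b]` -/
  | mul (r a b : ℕ)
  /-- `R[r] := ⌊R[a] / R[b]⌋` -/
  | div (r a b : ℕ)
  /-- `R[r] := M[R[a]]` -/
  | load (r a : ℕ)
  /-- `M[R[a]] := R[b]` -/
  | store (a b : ℕ)
  /-- go to instruction `l` -/
  | jump (l : ℕ)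
  /-- go to instruction `l` if `R[a] < R[b]` -/
  | jumpLt (a b l : ℕ)
  /-- stop -/
  | halt

/-- A configuration: program counter, registers, and a memory of `mem.length` words. -/
structure Config where
  pc : ℕ
  reg : ℕ → ℕ
  mem : List ℕ

/-- Assign the value `v`, reduced to a word of `W` bits, to register `r` and advance. -/
def Config.assign (W : ℕ) (c : Config) (r v : ℕ) : Config :=
  { c with pc := c.pc + 1, reg := Function.update c.reg r (v % 2 ^ W) }

/-- One step of the machine with `W`-bit words. There is no next configuration after `halt`, after
leaving the program, or on an access outside the memory. -/
def step (W : ℕ) (P : List Instr) (c : Config) : Option Config :=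
  match P[c.pc]? with
  | none => none
  | some (.const r k) => some (c.assign W r k)
  | some (.copy r a) => some (c.assign W r (c.reg a))
  | some (.add r a b) => some (c.assign W r (c.reg a + c.reg b))
  | some (.sub r a b) => some (c.assign W r (c.reg a - c.reg b))
  | some (.mul r a b) => some (c.assign W r (c.reg a * c.reg b))
  | some (.div r a b) => some (c.assign W r (c.reg a / c.reg b))
  | some (.load r a) => (c.mem[c.reg a]?).map fun v => c.assign W r v
  | some (.store a b) =>
      if c.reg a < c.mem.length then
        some { c with pc := c.pc + 1, mem := c.mem.set (c.reg a) (c.reg b) }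
      else none
  | some (.jump l) => some { c with pc := l }
  | some (.jumpLt a b l) =>
      some { c with pc := if c.reg a < c.reg b then l else c.pc + 1 }
  | some .halt => none

/-- The configuration reached after exactly `k` steps, if there is one. -/
def run (W : ℕ) (P : List Instr) : ℕ → Config → Option Config
  | 0, c => some c
  | k + 1, c => (step W P c).bind (run W P k)

/-- The initial configuration: the arguments are in the first registers, and all the others
are `0`. -/
def start (mem args : List ℕ) : Config :=
  { pc := 0, reg := fun r => args.getD r 0, mem := mem }

/-- On the memory `mem` and the arguments `args`, the program `P` halts within `T` steps with
`out` in register `0`, and it leaves the memory as it found it (so that the memory is ready for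
the next query). -/
def Answers (W : ℕ) (P : List Instr) (mem args : List ℕ) (T out : ℕ) : Prop :=
  ∃ k ≤ T, ∃ c : Config, run W P k (start mem args) = some c ∧ P[c.pc]? = some Instr.halt ∧
    c.reg 0 = out ∧ c.mem = mem

end RunLength

/-!
An index of size `O(g_rl)` is obtained by balancing a smallest run-length straight-line program: the
string has a derivation tree `t` (binary nodes and runs) of height `O(log n)` with `O(g_rl)`
distinct subtrees (`RLSLP.exists_balanced_tree`). The index stores one record per distinct subtree,
with its children, its length and its smallest symbol (`Stored`, `exists_stored`).

*Balancing.* The variables get a level (`RLSLP.level`), the logarithm of the length of the derived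
string plus `log n` minus the logarithm of the number of occurrences in the derivation tree. Levels
lie between `0` and `2 log n` and do not increase along the rules. The edges between variables of
equal level form disjoint paths, the symmetric centroid paths: two children of the same level would
be too long together (`RLSLP.Heavy.exists_split`), and a variable with two parents of the same level
would occur too often (`RLSLP.Heavy.parent_unique`). The copies in a power are never on a path below
it. A variable on a path derives a suffix of the sequence of items hanging to the left of the path
followed by a prefix of the sequence of items hanging to its right (`RLSLP.exists_path_items`), so
it suffices to build, with linearly many nodes, trees for all suffixes of a sequence in which an
item `x` has depth `O(1 + log (K / |x|))`, where `K` is the total length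
(`exists_suffix_trees`). The logarithms telescope along a branch, and the constants are paid for by the decrease of the level.

*Queries.* The last position at most `m` with a symbol below `d` is found by descending towards
position `m`. Instead of a stack it suffices to remember one candidate, the last subtree that ends
before position `m` and has a smallest symbol below `d`; if the descent fails, then the answer is
the last suitable position in the candidate, and a second descent guided by the smallest symbols
finds it (`RLTree.search_correct`). A descent in a run needs one division. The program for this
search is `searchCode`, and `reaches_searchCode` shows that it simulates the search. Queries for
next smaller values are the same search in the mirrored tree, which the same memory represents when the
two child fields are exchanged (`Stored.mirror`). The symbol `w[i]` needed for `psv` and `nsv` is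
found by the same search with every symbol suitable.
-/


namespace RunLength

/-! ### Derivation trees with runs -/

/-- A binary derivation tree with run nodes. Sharing equal subtrees turns such a tree into a
grammar, so the size of the grammar is the number of distinct subtrees. The node `pow t k` stands
for `k + 1` copies of `t`, which makes every derived string nonempty. -/
inductive RLTree where
  | leaf (a : ℕ)
  | pair (l r : RLTree)
  | pow (t : RLTree) (k : ℕ)
  deriving DecidableEq

namespace RLTree

/-- The string derived by a tree. -/
def str : RLTree → List ℕ
  | leaf a => [a]
  | pair l r => l.str ++ r.str
  | pow t k => (List.replicate (k + 1) t.str).flatten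

/-- The length of the derived string. -/
def len : RLTree → ℕ
  | leaf _ => 1
  | pair l r => l.len + r.len
  | pow t k => (k + 1) * t.len

/-- The smallest symbol of the derived string. -/
def minSym : RLTree → ℕ
  | leaf a => a
  | pair l r => min l.minSym r.minSym
  | pow t _ => t.minSym

/-- The height of a tree, where leaves have height `0`. -/
def height : RLTree → ℕ
  | leaf _ => 0
  | pair l r => max l.height r.height + 1
  | pow t _ => t.height + 1

/-- The set of distinct subtrees, that is, the nodes of the shared representation. -/
def subterms : RLTree → Finset RLTree
  | leaf a => {leaf a}
  | pair l r => insert (pair l r) (l.subterms ∪ r.subterms)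
  | pow t k => insert (pow t k) t.subterms

/-- The tree of the reversed string. -/
def mirror : RLTree → RLTree
  | leaf a => leaf a
  | pair l r => pair r.mirror l.mirror
  | pow t k => pow t.mirror k

@[simp] theorem length_str (t : RLTree) : t.str.length = t.len := by
  induction t with
  | leaf a => rfl
  | pair l r hl hr => simp [str, len, hl, hr]
  | pow t k h => simp [str, len, h]

theorem len_pos (t : RLTree) : 0 < t.len := by
  induction t with
  | leaf a => simp [len]
  | pair l r hl hr => simp [len]; omega
  | pow t k h => simp [len, h]

@[simp] theorem mirror_mirror (t : RLTree) : t.mirror.mirror = t := by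
  induction t with
  | leaf a => rfl
  | pair l r hl hr => simp [mirror, hl, hr]
  | pow t k h => simp [mirror, h]

theorem str_mirror (t : RLTree) : t.mirror.str = t.str.reverse := by
  induction t with
  | leaf a => rfl
  | pair l r hl hr => simp [mirror, str, hl, hr]
  | pow t k h => simp [mirror, str, h, List.reverse_flatten]

@[simp] theorem len_mirror (t : RLTree) : t.mirror.len = t.len := by
  rw [← length_str, str_mirror, List.length_reverse, length_str]

@[simp] theorem height_mirror (t : RLTree) : t.mirror.height = t.height := by
  induction t with
  | leaf a => rfl
  | pair l r hl hr => simp [mirror, height, hl, hr, max_comm]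
  | pow t k h => simp [mirror, height, h]

@[simp] theorem minSym_mirror (t : RLTree) : t.mirror.minSym = t.minSym := by
  induction t with
  | leaf a => rfl
  | pair l r hl hr => simp [mirror, minSym, hl, hr, min_comm]
  | pow t k h => simp [mirror, minSym, h]

theorem subterms_mirror (t : RLTree) : t.mirror.subterms = t.subterms.image mirror := by
  induction t with
  | leaf a => simp [mirror, subterms]
  | pair l r hl hr =>
    simp [mirror, subterms, hl, hr, Finset.image_insert, Finset.image_union, Finset.union_comm]
  | pow t k h => simp [mirror, subterms, h, Finset.image_insert]

theorem self_mem_subterms (t : RLTree) : t ∈ t.subterms := by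
  cases t <;> simp [subterms]

theorem subterms_trans {s t : RLTree} (h : s ∈ t.subterms) : s.subterms ⊆ t.subterms := by
  induction t with
  | leaf a => simp only [subterms, Finset.mem_singleton] at h; subst h; rfl
  | pair l r hl hr =>
    simp only [subterms, Finset.mem_insert, Finset.mem_union] at h
    rcases h with rfl | h | h
    · rfl
    · exact (hl h).trans (Finset.subset_union_left.trans (Finset.subset_insert _ _))
    · exact (hr h).trans (Finset.subset_union_right.trans (Finset.subset_insert _ _))
  | pow t k ih =>
    simp only [subterms, Finset.mem_insert] at h
    rcases h with rfl | h
    · rfl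
    · exact (ih h).trans (Finset.subset_insert _ _)

theorem mem_subterms_left (l r : RLTree) : l ∈ (pair l r).subterms := by
  simp [subterms, self_mem_subterms]

theorem mem_subterms_right (l r : RLTree) : r ∈ (pair l r).subterms := by
  simp [subterms, self_mem_subterms]

theorem mem_subterms_pow (t : RLTree) (k : ℕ) : t ∈ (pow t k).subterms := by
  simp [subterms, self_mem_subterms]

theorem len_le_of_mem_subterms {s t : RLTree} (h : s ∈ t.subterms) : s.len ≤ t.len := by
  induction t with
  | leaf a => simp only [subterms, Finset.mem_singleton] at h; subst h; rfl
  | pair l r hl hr =>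
    simp only [subterms, Finset.mem_insert, Finset.mem_union] at h
    rcases h with rfl | h | h
    · rfl
    · have := hl h; simp only [len]; omega
    · have := hr h; simp only [len]; omega
  | pow t k ih =>
    simp only [subterms, Finset.mem_insert] at h
    rcases h with rfl | h
    · rfl
    · exact (ih h).trans (Nat.le_mul_of_pos_left _ (Nat.succ_pos k))

theorem minSym_mem_str (t : RLTree) : t.minSym ∈ t.str := by
  induction t with
  | leaf a => simp [minSym, str]
  | pair l r hl hr =>
    simp only [minSym, str, List.mem_append]
    rcases min_choice l.minSym r.minSym with h | h <;> rw [h] <;> simp [hl, hr]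
  | pow t k h => simp [minSym, str, List.replicate_succ, h]

theorem minSym_le {t : RLTree} {a : ℕ} (h : a ∈ t.str) : t.minSym ≤ a := by
  induction t with
  | leaf b => simp_all [minSym, str]
  | pair l r hl hr =>
    simp only [str, List.mem_append] at h
    simp only [minSym]
    rcases h with h | h
    · exact (min_le_left _ _).trans (hl h)
    · exact (min_le_right _ _).trans (hr h)
  | pow t k ih =>
    simp only [str, List.mem_flatten, List.mem_replicate] at h
    obtain ⟨x, ⟨-, rfl⟩, h⟩ := h
    exact ih h

theorem str_subset_of_mem_subterms {s t : RLTree} (h : s ∈ t.subterms) : s.str ⊆ t.str := by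
  induction t with
  | leaf a => simp only [subterms, Finset.mem_singleton] at h; subst h; simp
  | pair l r hl hr =>
    simp only [subterms, Finset.mem_insert, Finset.mem_union] at h
    rcases h with rfl | h | h
    · simp
    · exact fun x hx => by simp [str, hl h hx]
    · exact fun x hx => by simp [str, hr h hx]
  | pow t k ih =>
    simp only [subterms, Finset.mem_insert] at h
    rcases h with rfl | h
    · simp
    · exact fun x hx => by simp [str, List.replicate_succ, ih h hx]

end RLTree

/-! ### Trees for all suffixes of a weighted sequence -/

theorem suffix_append_cases {α : Type*} {s u v : List α} (h : s <:+ u ++ v) :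
    s <:+ v ∨ ∃ u', u' ≠ [] ∧ u' <:+ u ∧ s = u' ++ v := by
  obtain ⟨p, hp⟩ := h
  rcases List.append_eq_append_iff.1 hp with ⟨c, rfl, rfl⟩ | ⟨c, rfl, rfl⟩
  · by_cases hc : c = []
    · subst hc; exact Or.inl (by simp)
    · exact Or.inr ⟨c, hc, List.suffix_append _ _, rfl⟩
  · exact Or.inl (List.suffix_append _ _)

/-- A nonempty weighted list splits at an item where the prefix sum of the weights exceeds `T`. -/
theorem exists_weighted_split {α : Type*} (w : α → ℕ) (l : List α) (hl : l ≠ []) (T : ℕ) :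
    ∃ u a v, l = u ++ a :: v ∧ (u.map w).sum ≤ T ∧ (v = [] ∨ T < (u.map w).sum + w a) := by
  induction l generalizing T with
  | nil => exact absurd rfl hl
  | cons x r ih =>
    by_cases hr : r = []
    · exact ⟨[], x, [], by simp [hr], by simp, Or.inl rfl⟩
    by_cases hx : T < w x
    · exact ⟨[], x, r, by simp, by simp, Or.inr (by simpa using hx)⟩
    obtain ⟨u, a, v, rfl, hu, hv⟩ := ih hr (T - w x)
    refine ⟨x :: u, a, v, by simp, ?_, ?_⟩
    · simp only [List.map_cons, List.sum_cons]; omega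
    · refine hv.imp_right fun h => ?_
      simp only [List.map_cons, List.sum_cons]; omega

open RLTree in
/-- Splitting recursively at the weighted median puts an item of weight `x.2` at depth about
`2 log (S / x.2)`, where `S` is the total weight. Here every suffix gets its own nodes along the
path of splits, so each level of the recursion costs a linear number of nodes; a lower bound `μ`
on the weights limits the number of levels. -/
theorem exists_biased_suffixes (E : Finset RLTree) (μ : ℕ) (l : List (RLTree × ℕ)) (B : ℕ)
    (hμ : ∀ x ∈ l, μ ≤ x.2 ∧ 1 ≤ x.2 ∧ x.1.subterms ⊆ E)
    (hB : ∀ x ∈ l, x.1.height + 2 * (Nat.log 2 (l.map Prod.snd).sum - Nat.log 2 x.2) ≤ B) :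
    ∃ F : Finset RLTree,
      F.card ≤ 2 * l.length * (Nat.log 2 (l.map Prod.snd).sum - Nat.log 2 μ + 1) ∧
      ∀ s, s <:+ l → s ≠ [] →
        ∃ t : RLTree, t.str = s.flatMap (fun x => x.1.str) ∧ t.height ≤ B + 2 ∧
          t.subterms ⊆ F ∪ E := by
  induction hn : l.length using Nat.strong_induction_on generalizing l B with
  | _ n ih =>
  by_cases hl : l = []
  · subst hl
    exact ⟨∅, by simp, fun s hs hne => absurd (List.suffix_nil.1 hs) hne⟩
  set S := (l.map Prod.snd).sum with hS
  obtain ⟨u, a, v, rfl, hu, hv⟩ := exists_weighted_split Prod.snd l hl (S / 2)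
  simp only [List.map_append, List.map_cons, List.sum_append, List.sum_cons] at hS
  set U := (u.map Prod.snd).sum
  set V := (v.map Prod.snd).sum
  have hV : V ≤ S / 2 := by
    rcases hv with rfl | h
    · simp [V]
    · omega
  -- One half of the split, with the budget lowered by the two levels above it.
  have half : ∀ r : List (RLTree × ℕ), r ⊆ u ++ a :: v → r.length < n →
      (r.map Prod.snd).sum ≤ S / 2 →
      ∃ F : Finset RLTree, F.card ≤ 2 * r.length * (Nat.log 2 S - Nat.log 2 μ) ∧
      ∀ s, s <:+ r → s ≠ [] →
        ∃ t : RLTree, t.str = s.flatMap (fun x => x.1.str) ∧ t.height ≤ B ∧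
          t.subterms ⊆ F ∪ E := by
    intro r hr hrn hrS
    by_cases hr0 : r = []
    · subst hr0
      exact ⟨∅, by simp, fun s hs hne => absurd (List.suffix_nil.1 hs) hne⟩
    have hpos : ∀ x ∈ r, x.2 ≤ (r.map Prod.snd).sum := fun x hx =>
      List.single_le_sum (by simp) _ (List.mem_map_of_mem (f := Prod.snd) hx)
    obtain ⟨y, hy⟩ := List.exists_mem_of_ne_nil r hr0
    have hS2 : 1 ≤ S / 2 := (hμ y (hr hy)).2.1.trans ((hpos y hy).trans hrS)
    have hlog : Nat.log 2 (r.map Prod.snd).sum ≤ Nat.log 2 S - 1 := by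
      rw [← Nat.log_div_base]; exact Nat.log_mono_right hrS
    have hS1 : 1 ≤ Nat.log 2 S := Nat.log_pos (by norm_num) (by omega)
    have hx2 : ∀ x ∈ r, x.1.height +
        2 * (Nat.log 2 (r.map Prod.snd).sum - Nat.log 2 x.2) + 2 ≤ B := by
      intro x hx
      have h1 := hB x (hr hx)
      have h2 : Nat.log 2 x.2 ≤ Nat.log 2 (r.map Prod.snd).sum := Nat.log_mono_right (hpos x hx)
      omega
    obtain ⟨F, hF, hs⟩ := ih r.length hrn r (B - 2) (fun x hx => hμ x (hr hx))
      (fun x hx => by have := hx2 x hx; omega) rfl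
    have hB2 := hx2 y hy
    refine ⟨F, hF.trans ?_, fun s h1 h2 => ?_⟩
    · have h1 := Nat.log_mono_right (b := 2) (hμ y (hr hy)).1
      have h2 : Nat.log 2 y.2 ≤ Nat.log 2 (r.map Prod.snd).sum := Nat.log_mono_right (hpos y hy)
      exact Nat.mul_le_mul_left _ (by omega)
    · obtain ⟨t, ht1, ht2, ht3⟩ := hs s h1 h2
      exact ⟨t, ht1, by omega, ht3⟩
  simp only [List.length_append, List.length_cons] at hn
  obtain ⟨Fu, hFu, hsu⟩ := half u (by simp) (by omega) hu
  obtain ⟨Fv, hFv, hsv⟩ := half v (fun x hx => by simp [hx]) (by omega) hV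
  have hsu' : ∀ s, ∃ t : RLTree, s <:+ u → s ≠ [] →
      t.str = s.flatMap (fun x => x.1.str) ∧ t.height ≤ B ∧ t.subterms ⊆ Fu ∪ E := by
    intro s
    by_cases h : s <:+ u ∧ s ≠ []
    · obtain ⟨t, ht⟩ := hsu s h.1 h.2
      exact ⟨t, fun _ _ => ht⟩
    · exact ⟨leaf 0, fun h1 h2 => absurd ⟨h1, h2⟩ h⟩
  choose g hg using hsu'
  have haE := (hμ a (by simp)).2.2
  have haB := hB a (by simp)
  obtain ⟨ta, hta1, hta2, hta3⟩ : ∃ ta : RLTree,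
      ta.str = (a :: v).flatMap (fun x => x.1.str) ∧ ta.height ≤ B + 1 ∧
        ta.subterms ⊆ insert ta Fv ∪ E := by
    by_cases hv0 : v = []
    · exact ⟨a.1, by simp [hv0], by omega, haE.trans Finset.subset_union_right⟩
    · obtain ⟨tv, h1, h2, h3⟩ := hsv v (List.suffix_refl v) hv0
      refine ⟨pair a.1 tv, by simp [str, h1], by simp only [height]; omega, ?_⟩
      intro x hx
      simp only [subterms, Finset.mem_insert, Finset.mem_union] at hx ⊢
      rcases hx with h | h | h
      · exact Or.inl (Or.inl h)
      · exact Or.inr (haE h)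
      · rcases Finset.mem_union.1 (h3 h) with h | h
        · exact Or.inl (Or.inr h)
        · exact Or.inr h
  refine ⟨Fu ∪ (insert ta Fv ∪ (u.tails.map fun s => pair (g s) ta).toFinset), ?_, ?_⟩
  · have h1 := Finset.card_union_le Fu
      (insert ta Fv ∪ (u.tails.map fun s => pair (g s) ta).toFinset)
    have h2 := Finset.card_union_le (insert ta Fv) (u.tails.map fun s => pair (g s) ta).toFinset
    have h3 := Finset.card_insert_le ta Fv
    have h4 := List.toFinset_card_le (u.tails.map fun s => pair (g s) ta)
    simp only [List.length_map, List.length_tails] at h4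
    have h5 : 2 * n * (Nat.log 2 S - Nat.log 2 μ + 1) =
      2 * u.length * (Nat.log 2 S - Nat.log 2 μ) + 2 * v.length * (Nat.log 2 S - Nat.log 2 μ)
        + 2 * (Nat.log 2 S - Nat.log 2 μ) + 2 * n := by rw [← hn]; ring
    omega
  · intro s hs hne
    rcases suffix_append_cases hs with h | ⟨u', hu'0, hu', rfl⟩
    · rcases List.suffix_cons_iff.1 h with rfl | h
      · exact ⟨ta, hta1, by omega, hta3.trans (by
          intro x; simp only [Finset.mem_union]; tauto)⟩
      · obtain ⟨t, h1, h2, h3⟩ := hsv s h hne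
        exact ⟨t, h1, by omega, h3.trans (by
          intro x; simp only [Finset.mem_union, Finset.mem_insert]; tauto)⟩
    · obtain ⟨h1, h2, h3⟩ := hg u' hu' hu'0
      refine ⟨pair (g u') ta, by simp [str, h1, hta1], by simp only [height]; omega, ?_⟩
      have hmem : pair (g u') ta ∈ (u.tails.map fun s => pair (g s) ta).toFinset := by
        rw [List.mem_toFinset]
        exact List.mem_map_of_mem (f := fun s => pair (g s) ta) ((List.mem_tails _ _).2 hu')
      intro x hx
      simp only [subterms, Finset.mem_insert, Finset.mem_union] at hx
      rcases hx with rfl | h | h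
      · simp only [Finset.mem_union]; tauto
      · have := h3 h
        simp only [Finset.mem_union] at this ⊢; tauto
      · have := hta3 h
        simp only [Finset.mem_union] at this ⊢; tauto

/-- A list can be cut into singletons and runs of at most `L` light items; the number of blocks is
governed by the number of items that are not light. -/
theorem exists_blocks {α : Type*} (light : α → Prop) [DecidablePred light] (L : ℕ) (hL : 1 ≤ L)
    (l : List α) :
    ∃ bs : List (List α), bs.flatten = l ∧
      (∀ b ∈ bs, b ≠ [] ∧ (b.length = 1 ∨ b.length ≤ L ∧ ∀ x ∈ b, light x)) ∧
      bs.length * L ≤ l.length + 2 * L * l.countP (fun x => ¬ light x) + L := by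
  -- A first block that is a light run may still grow, so only its actual length is charged.
  have key : l = [] ∨ ∃ (b : List α) (bs : List (List α)), (b :: bs).flatten = l ∧
      (∀ b' ∈ b :: bs, b' ≠ [] ∧ (b'.length = 1 ∨ b'.length ≤ L ∧ ∀ x ∈ b', light x)) ∧
      ((b.length ≤ L ∧ (∀ x ∈ b, light x) ∧
          bs.length * L + b.length ≤ l.length + 2 * L * l.countP (fun x => ¬ light x)) ∨
        (bs.length + 1) * L ≤ l.length + 2 * L * l.countP (fun x => ¬ light x)) := by
    induction l with
    | nil => exact Or.inl rfl
    | cons x l ih =>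
      right
      by_cases hx : light x
      · simp only [List.length_cons, List.countP_cons, hx, not_true_eq_false, decide_false,
          Bool.false_eq_true, if_false, add_zero]
        rcases ih with rfl | ⟨b, bs, hfl, hbs, hcase⟩
        · exact ⟨[x], [], by simp, by simp, Or.inl ⟨hL, by simpa using hx, by simp⟩⟩
        · by_cases hb : b.length < L ∧ (∀ x ∈ b, light x) ∧
            bs.length * L + b.length ≤ l.length + 2 * L * l.countP (fun x => ¬ light x)
          · obtain ⟨h1, h2, h3⟩ := hb
            have h4 : ∀ y ∈ x :: b, light y := by simpa [hx] using h2
            refine ⟨x :: b, bs, by simpa using hfl, ?_, Or.inl ⟨by simpa using h1, h4, ?_⟩⟩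
            · intro b' hb'
              rcases List.mem_cons.1 hb' with rfl | hb'
              · exact ⟨by simp, Or.inr ⟨by simpa using h1, h4⟩⟩
              · exact hbs b' (by simp [hb'])
            · simp only [List.length_cons]; omega
          · refine ⟨[x], b :: bs, by simpa using hfl, ?_, Or.inl ⟨hL, by simpa using hx, ?_⟩⟩
            · intro b' hb'
              rcases List.mem_cons.1 hb' with rfl | hb'
              · simp
              · exact hbs b' hb'
            · simp only [List.length_cons, List.length_nil, Nat.add_mul, one_mul]
              rcases hcase with ⟨h1, h2, h3⟩ | h
              · have : b.length = L := by
                  by_contra hne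
                  exact hb ⟨by omega, h2, h3⟩
                omega
              · rw [Nat.add_mul] at h; omega
      · simp only [List.length_cons, List.countP_cons, hx, not_false_eq_true, decide_true,
          if_true]
        rcases ih with rfl | ⟨b, bs, hfl, hbs, hcase⟩
        · refine ⟨[x], [], by simp, by simp, Or.inr ?_⟩
          simp only [List.length_nil, List.countP_nil]; omega
        · refine ⟨[x], b :: bs, by simpa using hfl, ?_, Or.inr ?_⟩
          · intro b' hb'
            rcases List.mem_cons.1 hb' with rfl | hb'
            · simp
            · exact hbs b' hb'
          · simp only [List.length_cons, Nat.add_mul, one_mul, Nat.mul_add, mul_one] at hcase ⊢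
            omega
  rcases key with rfl | ⟨b, bs, h1, h2, h3⟩
  · exact ⟨[], by simp⟩
  · refine ⟨b :: bs, h1, h2, ?_⟩
    simp only [List.length_cons, Nat.add_mul, one_mul] at h3 ⊢
    omega

namespace RLTree

/-- The right comb over a nonempty list of trees. -/
def comb : List RLTree → RLTree
  | [] => leaf 0
  | [x] => x
  | x :: y :: r => pair x (comb (y :: r))

theorem str_comb {b : List RLTree} (hb : b ≠ []) : (comb b).str = b.flatMap str := by
  induction b with
  | nil => exact absurd rfl hb
  | cons x r ih =>
    cases r with
    | nil => simp [comb]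
    | cons y r => rw [comb, str, ih (by simp)]; rfl

theorem height_comb_le {b : List RLTree} (hb : b ≠ []) {M : ℕ}
    (h : ∀ x ∈ b, x.height + (b.length - 1) ≤ M) : (comb b).height ≤ M := by
  induction b generalizing M with
  | nil => exact absurd rfl hb
  | cons x r ih =>
    cases r with
    | nil => simpa [comb] using h
    | cons y r =>
      have hx := h x (by simp)
      simp only [List.length_cons] at hx
      have := ih (M := M - 1) (by simp) fun z hz => by
        have := h z (by simp [List.mem_cons.1 hz])
        simp only [List.length_cons] at this ⊢
        omega
      simp only [comb, height]
      omega

theorem subterms_comb_subset {E : Finset RLTree} {b : List RLTree} (hb : b ≠ [])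
    (hE : ∀ x ∈ b, x.subterms ⊆ E) :
    (comb b).subterms ⊆ (b.tails.map comb).toFinset ∪ E := by
  induction b with
  | nil => exact absurd rfl hb
  | cons x r ih =>
    cases r with
    | nil => exact (hE x (by simp)).trans Finset.subset_union_right
    | cons y r =>
      have h1 := ih (by simp) fun z hz => hE z (by simp [List.mem_cons.1 hz])
      intro z hz
      simp only [comb, subterms, Finset.mem_insert, Finset.mem_union] at hz
      rcases hz with rfl | hz | hz
      · simp [comb]
      · exact Finset.mem_union_right _ (hE x (by simp) hz)
      · have := h1 hz
        rw [List.tails_cons, List.map_cons, List.toFinset_cons]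
        simp only [Finset.mem_union, Finset.mem_insert] at this ⊢
        tauto

end RLTree

theorem suffix_flatten_cases {α : Type*} {bs : List (List α)} {s : List α}
    (h : s <:+ bs.flatten) (hs : s ≠ []) :
    ∃ b b' bs', (b :: bs') <:+ bs ∧ b' <:+ b ∧ b' ≠ [] ∧ s = b' ++ bs'.flatten := by
  induction bs with
  | nil => exact absurd (List.suffix_nil.1 h) hs
  | cons b bs ih =>
    rw [List.flatten_cons] at h
    rcases suffix_append_cases h with h | ⟨b', h1, h2, h3⟩
    · obtain ⟨c, c', cs, h1, h2⟩ := ih h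
      exact ⟨c, c', cs, h1.trans (List.suffix_cons _ _), h2⟩
    · exact ⟨b, b', bs, List.suffix_refl _, h2, h1, h3⟩

theorem countP_mul_le {α : Type*} (p : α → Bool) (w : α → ℕ) (c c' : ℕ) (l : List α)
    (h : ∀ x ∈ l, p x → c ≤ c' * w x) : l.countP p * c ≤ c' * (l.map w).sum := by
  induction l with
  | nil => simp
  | cons x l ih =>
    have h1 := ih fun y hy => h y (by simp [hy])
    have h2 := h x (by simp)
    simp only [List.countP_cons, List.map_cons, List.sum_cons, Nat.mul_add, Nat.add_mul]
    split_ifs with hx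
    · have := h2 hx; omega
    · omega

/-- With `m` items there are at most about `√m` items of weight above `K / √m`. -/
theorem countP_heavy_mul_le {α : Type*} (w : α → ℕ) (hw : ∀ x, 0 < w x) (l : List α) (hl : l ≠ [])
    (K : ℕ) (hK : (l.map w).sum ≤ K) :
    (Nat.log 2 l.length + 1) *
      l.countP (fun x => ¬ (Nat.log 2 l.length + 1 ≤ 2 * (Nat.log 2 K - Nat.log 2 (w x)))) ≤
      4 * l.length := by
  set e := Nat.log 2 l.length with he
  have hm : 2 ^ e ≤ l.length := Nat.pow_log_le_self 2 (by simpa using hl)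
  have h1 := countP_mul_le (fun x => ¬ (e + 1 ≤ 2 * (Nat.log 2 K - Nat.log 2 (w x)))) w
    (2 ^ Nat.log 2 K) (2 ^ (e / 2)) l (by
      intro x _ hx
      simp only [not_le, decide_eq_true_eq] at hx
      calc 2 ^ Nat.log 2 K ≤ 2 ^ (e / 2 + Nat.log 2 (w x)) :=
            Nat.pow_le_pow_right (by norm_num) (by omega)
        _ = 2 ^ (e / 2) * 2 ^ Nat.log 2 (w x) := pow_add _ _ _
        _ ≤ 2 ^ (e / 2) * w x := Nat.mul_le_mul_left _ (Nat.pow_log_le_self 2 (hw x).ne'))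
  set hv := l.countP (fun x => ¬ (e + 1 ≤ 2 * (Nat.log 2 K - Nat.log 2 (w x))))
  have h2 : hv ≤ 2 ^ (e / 2) * 2 := by
    have h3 : K < 2 ^ (Nat.log 2 K + 1) := Nat.lt_pow_succ_log_self (by norm_num) K
    have h4 : hv * 2 ^ Nat.log 2 K ≤ (2 ^ (e / 2) * 2) * 2 ^ Nat.log 2 K := by
      calc hv * 2 ^ Nat.log 2 K ≤ 2 ^ (e / 2) * K := h1.trans (Nat.mul_le_mul_left _ hK)
        _ ≤ 2 ^ (e / 2) * 2 ^ (Nat.log 2 K + 1) := Nat.mul_le_mul_left _ h3.le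
        _ = _ := by rw [pow_succ]; ring
    exact Nat.le_of_mul_le_mul_right h4 (by positivity)
  have h5 : e + 1 ≤ 2 * 2 ^ (e - e / 2) := by
    have : e - e / 2 < 2 ^ (e - e / 2) := Nat.lt_two_pow_self
    omega
  calc (e + 1) * hv ≤ (2 * 2 ^ (e - e / 2)) * (2 ^ (e / 2) * 2) := Nat.mul_le_mul h5 h2
    _ = 4 * 2 ^ (e - e / 2 + e / 2) := by rw [pow_add]; ring
    _ = 4 * 2 ^ e := by rw [Nat.sub_add_cancel (Nat.div_le_self _ _)]
    _ ≤ 4 * l.length := Nat.mul_le_mul_left _ hm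

open RLTree in
/-- Linearly many nodes suffice for trees of all suffixes of a list of trees of total length at
most `K`, such that an item `x` sits at depth `O(1 + log (K / x.len))` in each of them.

With `m` items, light items (those of length at most `K / √m`, roughly) are grouped into runs of
at most `log m` items, and the `O(m / log m)` resulting blocks are arranged by
`exists_biased_suffixes` after adding `K / m` to each weight, which costs `O(log m)` nodes per
block. A suffix consists of a suffix of a block, a right comb whose height is paid for by the
lightness of its items, and a suffix of the sequence of blocks. -/
theorem exists_suffix_trees (E : Finset RLTree) (l : List RLTree) (hE : ∀ x ∈ l, x.subterms ⊆ E)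
    (K : ℕ) (hK : (l.map len).sum ≤ K) (B : ℕ)
    (hB : ∀ x ∈ l, x.height + 4 * (Nat.log 2 K - Nat.log 2 x.len) ≤ B) :
    ∃ F : Finset RLTree, F.card ≤ 84 * l.length ∧
      ∀ s, s <:+ l → s ≠ [] →
        ∃ t : RLTree, t.str = s.flatMap str ∧ t.height ≤ B + 7 ∧ t.subterms ⊆ F ∪ E := by
  by_cases hl : l = []
  · subst hl
    exact ⟨∅, by simp, fun s hs hne => absurd (List.suffix_nil.1 hs) hne⟩
  have hheavy := countP_heavy_mul_le len len_pos l hl K hK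
  set e := Nat.log 2 l.length with he
  have hm1 : 1 ≤ l.length := List.length_pos_iff.2 hl
  obtain ⟨bs, hfl, hbs, hcnt⟩ := exists_blocks
    (fun x : RLTree => e + 1 ≤ 2 * (Nat.log 2 K - Nat.log 2 x.len)) (e + 1) (by omega) l
  have heL : e + 1 ≤ l.length :=
    (Nat.lt_two_pow_self (n := e)).trans_le (Nat.pow_log_le_self 2 (by omega))
  have hmK : l.length ≤ K := by
    refine le_trans ?_ hK
    have := List.card_nsmul_le_sum (l.map len) 1 (by
      intro x hx
      obtain ⟨y, -, rfl⟩ := List.mem_map.1 hx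
      exact len_pos y)
    simpa using this
  have hβm : bs.length ≤ l.length := by
    rw [← hfl, List.length_flatten]
    have := List.card_nsmul_le_sum (bs.map List.length) 1 (by
      intro x hx
      obtain ⟨y, hy, rfl⟩ := List.mem_map.1 hx
      exact List.length_pos_iff.2 (hbs y hy).1)
    simpa using this
  have hmemb : ∀ b ∈ bs, ∀ x ∈ b, x ∈ l := fun b hb x hx => by
    rw [← hfl]; exact List.mem_flatten.2 ⟨b, hb, hx⟩
  set μ := K / l.length + 1 with hμ
  set it : List RLTree → RLTree × ℕ := fun b => (comb b, (b.map len).sum + μ) with hit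
  set S := ((bs.map it).map Prod.snd).sum with hS
  have hSK : S ≤ 3 * K := by
    have h1 : S = (l.map len).sum + bs.length * μ := by
      rw [hS, ← hfl, List.map_map]
      clear_value μ
      clear hcnt hbs hfl hβm hmemb hS S
      induction bs with
      | nil => simp
      | cons b bs ih =>
        simp only [List.map_cons, List.sum_cons, ih, List.flatten_cons, List.map_append,
          List.sum_append, List.length_cons]
        simp only [Function.comp, hit]
        ring
    have h2 : bs.length * μ ≤ K + l.length := by
      calc bs.length * μ ≤ l.length * μ := Nat.mul_le_mul_right _ hβm
        _ = l.length * (K / l.length) + l.length := by rw [hμ]; ring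
        _ ≤ K + l.length := by have := Nat.mul_div_le K l.length; omega
    omega
  have hlogS : Nat.log 2 S ≤ Nat.log 2 K + 2 := by
    calc Nat.log 2 S ≤ Nat.log 2 (K * 2 * 2) := Nat.log_mono_right (by omega)
      _ = Nat.log 2 K + 2 := by
        rw [Nat.log_mul_base (by norm_num) (by omega), Nat.log_mul_base (by norm_num) (by omega)]
  have hlogμ : Nat.log 2 K ≤ Nat.log 2 μ + e + 1 := by
    have h1 : K < μ * l.length := by
      rw [hμ, Nat.add_mul, one_mul, mul_comm]
      have h1 := Nat.div_add_mod K l.length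
      have h2 := Nat.mod_lt K hm1
      omega
    have h2 : K < 2 ^ (Nat.log 2 μ + e + 2) := by
      refine h1.trans_le ?_
      rw [show Nat.log 2 μ + e + 2 = (Nat.log 2 μ + 1) + (e + 1) by ring, pow_add]
      exact Nat.mul_le_mul (Nat.lt_pow_succ_log_self (by norm_num) _).le
        (Nat.lt_pow_succ_log_self (by norm_num) _).le
    have := Nat.log_lt_of_lt_pow (by omega) h2
    omega
  set combs := ((bs.flatMap List.tails).map comb).toFinset with hcombs
  have hcombE : ∀ b ∈ bs, ∀ b', b' <:+ b → b' ≠ [] → (comb b').subterms ⊆ combs ∪ E := by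
    intro b hb b' hb' hne
    refine (subterms_comb_subset hne fun x hx => hE x (hmemb b hb x (hb'.subset hx))).trans ?_
    refine Finset.union_subset_union_left ?_
    intro z hz
    rw [List.mem_toFinset, List.mem_map] at hz
    obtain ⟨y, hy, rfl⟩ := hz
    rw [hcombs, List.mem_toFinset]
    refine List.mem_map_of_mem (List.mem_flatMap.2 ⟨b, hb, ?_⟩)
    rw [List.mem_tails] at hy ⊢
    exact hy.trans hb'
  have hcombcard : combs.card ≤ 2 * l.length := by
    refine (List.toFinset_card_le _).trans ?_
    have : (bs.flatMap List.tails).length = bs.flatten.length + bs.length := by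
      clear_value combs S e
      clear * -
      induction bs with
      | nil => rfl
      | cons b bs ih => simp [ih]; omega
    rw [List.length_map, this, hfl]; omega
  obtain ⟨F, hF, hsuf⟩ := exists_biased_suffixes (combs ∪ E) μ (bs.map it) (B + 4)
    (by
      intro x hx
      obtain ⟨b, hb, rfl⟩ := List.mem_map.1 hx
      exact ⟨by simp [hit], 
        (Nat.succ_le_succ (Nat.zero_le _)).trans (Nat.le_add_left μ _),
        hcombE b hb b (List.suffix_refl b) (hbs b hb).1⟩)
    (by
      intro x hx
      obtain ⟨b, hb, rfl⟩ := List.mem_map.1 hx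
      have hlen : ∀ y ∈ b, Nat.log 2 y.len ≤ Nat.log 2 (it b).2 := fun y hy =>
        Nat.log_mono_right (le_trans (List.single_le_sum (by simp) _ (List.mem_map_of_mem hy))
          (Nat.le_add_right _ _))
      have key : ∀ y ∈ b, y.height + (b.length - 1) +
          2 * (Nat.log 2 S - Nat.log 2 (it b).2) ≤ B + 4 := by
        intro y hy
        have h1 := hB y (hmemb b hb y hy)
        have h2 := hlen y hy
        rcases (hbs b hb).2 with h3 | ⟨h3, h4⟩
        · omega
        · have := h4 y hy
          omega
      obtain ⟨y, hy⟩ := List.exists_mem_of_ne_nil b (hbs b hb).1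
      have h1 := key y hy
      have h2 : (comb b).height ≤ B + 4 - 2 * (Nat.log 2 S - Nat.log 2 (it b).2) :=
        height_comb_le (hbs b hb).1 fun z hz => by have := key z hz; omega
      show (comb b).height + 2 * (Nat.log 2 S - Nat.log 2 (it b).2) ≤ B + 4
      omega)
  have hT : ∀ s, ∃ t : RLTree, s <:+ l → s ≠ [] →
      t.str = s.flatMap str ∧ t.height ≤ B + 7 ∧ t.subterms ⊆ insert t (F ∪ combs) ∪ E := by
    intro s
    by_cases hs : s <:+ l ∧ s ≠ []
    · rw [← hfl] at hs
      obtain ⟨b, b', bs', h1, h2, h3, rfl⟩ := suffix_flatten_cases hs.1 hs.2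
      have hb : b ∈ bs := h1.subset (by simp)
      have h4 := hcombE b hb b' h2 h3
      have h5 : (comb b').height ≤ B := height_comb_le h3 fun x hx => by
        have h6 := hB x (hmemb b hb x (h2.subset hx))
        have h7 := h2.length_le
        rcases (hbs b hb).2 with h8 | ⟨h8, h9⟩
        · omega
        · have := h9 x (h2.subset hx)
          omega
      by_cases hbs' : bs' = []
      · refine ⟨comb b', fun _ _ => ⟨by simp [hbs', str_comb h3], by omega, h4.trans ?_⟩⟩
        intro x; simp only [Finset.mem_union, Finset.mem_insert]; tauto
      · obtain ⟨t, ht1, ht2, ht3⟩ := hsuf (bs'.map it)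
          (((List.suffix_cons _ _).trans h1).map it) (by simpa using hbs')
        refine ⟨pair (comb b') t, fun _ _ => ⟨?_, by simp only [height]; omega, ?_⟩⟩
        · rw [str, str_comb h3, ht1, List.flatMap_append]
          congr 1
          have hne : ∀ c ∈ bs', c ≠ [] := fun c hc => (hbs c (h1.subset (by simp [hc]))).1
          clear * - hne
          induction bs' with
          | nil => rfl
          | cons c cs ih =>
            simp only [List.map_cons, List.flatMap_cons, List.flatten_cons, List.flatMap_append]
            rw [ih fun d hd => hne d (by simp [hd])]
            exact congrArg (· ++ _) (str_comb (hne c (by simp)))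
        · intro x hx
          simp only [subterms, Finset.mem_insert, Finset.mem_union] at hx
          rcases hx with rfl | h | h
          · simp
          · have := h4 h
            simp only [Finset.mem_union, Finset.mem_insert] at this ⊢; tauto
          · have := ht3 h
            simp only [Finset.mem_union, Finset.mem_insert] at this ⊢; tauto
    · exact ⟨leaf 0, fun h1 h2 => absurd ⟨h1, h2⟩ hs⟩
  choose T hT using hT
  refine ⟨F ∪ combs ∪ (l.tails.map T).toFinset, ?_, ?_⟩
  · have h1 := Finset.card_union_le (F ∪ combs) (l.tails.map T).toFinset
    have h2 := Finset.card_union_le F combs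
    have h3 := List.toFinset_card_le (l.tails.map T)
    simp only [List.length_map, List.length_tails] at h3
    have h4 : F.card ≤ 8 * (bs.length * (e + 1)) := by
      refine hF.trans ?_
      rw [List.length_map]
      calc 2 * bs.length * (Nat.log 2 S - Nat.log 2 μ + 1)
          ≤ 2 * bs.length * (4 * (e + 1)) := Nat.mul_le_mul_left _ (by omega)
        _ = _ := by ring
    have h5 : bs.length * (e + 1) ≤ 10 * l.length := by
      refine hcnt.trans ?_
      rw [mul_assoc]
      omega
    omega
  · intro s hs hne
    obtain ⟨h1, h2, h3⟩ := hT s hs hne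
    refine ⟨T s, h1, h2, h3.trans ?_⟩
    have : T s ∈ (l.tails.map T).toFinset :=
      List.mem_toFinset.2 (List.mem_map_of_mem ((List.mem_tails _ _).2 hs))
    intro x hx
    simp only [Finset.mem_union, Finset.mem_insert] at hx ⊢
    rcases hx with (rfl | h | h) | h <;> tauto

open RLTree in
/-- The mirror image of `exists_suffix_trees`. -/
theorem exists_prefix_trees (E : Finset RLTree) (l : List RLTree) (hE : ∀ x ∈ l, x.subterms ⊆ E)
    (K : ℕ) (hK : (l.map len).sum ≤ K) (B : ℕ)
    (hB : ∀ x ∈ l, x.height + 4 * (Nat.log 2 K - Nat.log 2 x.len) ≤ B) :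
    ∃ F : Finset RLTree, F.card ≤ 84 * l.length ∧
      ∀ s, s <+: l → s ≠ [] →
        ∃ t : RLTree, t.str = s.flatMap str ∧ t.height ≤ B + 7 ∧ t.subterms ⊆ F ∪ E := by
  obtain ⟨F, hF, h⟩ := exists_suffix_trees (E.image mirror) (l.map mirror).reverse
    (by
      intro x hx
      simp only [List.mem_reverse, List.mem_map] at hx
      obtain ⟨y, hy, rfl⟩ := hx
      rw [subterms_mirror]
      exact Finset.image_subset_image (hE y hy)) K
    (by
      rw [List.map_reverse, List.sum_reverse, List.map_map]
      simpa [Function.comp_def] using hK) B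
    (by
      intro x hx
      simp only [List.mem_reverse, List.mem_map] at hx
      obtain ⟨y, hy, rfl⟩ := hx
      simpa using hB y hy)
  refine ⟨F.image mirror, Finset.card_image_le.trans (by simpa using hF), fun s hs hne => ?_⟩
  obtain ⟨t, h1, h2, h3⟩ := h (s.map mirror).reverse
    (List.reverse_suffix.2 (hs.map mirror)) (by simpa using hne)
  refine ⟨t.mirror, ?_, by simpa using h2, ?_⟩
  · rw [str_mirror, h1, ← List.map_reverse, List.flatMap_map]
    clear * -
    induction s with
    | nil => rfl
    | cons x s ih =>
      simp only [str_mirror] at ih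
      simp [str_mirror, ih]
  · rw [subterms_mirror]
    refine (Finset.image_subset_image h3).trans ?_
    rw [Finset.image_union, Finset.image_image]
    simp [Function.comp_def]

/-! ### Occurrences of variables in a grammar -/

namespace RLSLP

variable {α : Type}

/-- The variables on the right-hand side of `A`, with multiplicity; empty if `A` is not a
variable. -/
def children (G : RLSLP α) (A : ℕ) : List ℕ :=
  if hA : A < G.numVars then
    match G.rule ⟨A, hA⟩ with
    | .terminal _ => []
    | .concat vars _ => vars.map Fin.val
    | .power B t _ => List.replicate t B.val
  else []

/-- The string derived by `A`, or the empty string if `A` is not a variable. -/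
def val (G : RLSLP α) (A : ℕ) : List α :=
  if hA : A < G.numVars then G.exp A hA else []

/-- The size of the rule of `A`, or `0` if `A` is not a variable. -/
def ruleSize (G : RLSLP α) (A : ℕ) : ℕ :=
  if hA : A < G.numVars then (G.rule ⟨A, hA⟩).size else 0

theorem children_lt {G : RLSLP α} {A c : ℕ} (h : c ∈ G.children A) : c < A := by
  unfold children at h
  split at h
  · split at h
    · simp at h
    · obtain ⟨x, -, rfl⟩ := List.mem_map.1 h
      exact x.isLt
    · rw [List.eq_of_mem_replicate h]
      exact Fin.isLt _
  · simp at h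

theorem lt_numVars_of_mem_children {G : RLSLP α} {A c : ℕ} (h : c ∈ G.children A) :
    A < G.numVars := by
  by_contra hA
  simp [children, hA] at h

theorem rule_cases (G : RLSLP α) {A : ℕ} (hA : A < G.numVars) :
    (∃ a, G.val A = [a] ∧ G.children A = [] ∧ G.ruleSize A = 1) ∨
    (G.val A = (G.children A).flatMap G.val ∧ 1 < (G.children A).length ∧
      (G.ruleSize A = (G.children A).length ∨
        G.ruleSize A = 2 ∧ ∃ B t, 2 < t ∧ G.children A = List.replicate t B)) := by
  unfold val children ruleSize
  simp only [hA, dif_pos]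
  rw [exp]
  cases hr : G.rule ⟨A, hA⟩ with
  | terminal a => exact Or.inl ⟨a, by simp, by simp, by simp [Rule.size]⟩
  | concat vars hk =>
    refine Or.inr ⟨?_, by simpa using hk, Or.inl (by simp [Rule.size])⟩
    simp only [List.flatMap_map]
    congr 1
    funext B
    rw [dif_pos (B.isLt.trans hA)]
  | power B t ht =>
    refine Or.inr ⟨?_, by simp; omega, Or.inr ⟨by simp [Rule.size], B.val, t, ht, rfl⟩⟩
    simp only [List.flatMap, List.map_replicate]
    rw [dif_pos (B.isLt.trans hA)]

theorem ruleSize_pos (G : RLSLP α) {A : ℕ} (hA : A < G.numVars) : 1 ≤ G.ruleSize A := by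
  rcases G.rule_cases hA with ⟨a, -, -, h⟩ | ⟨-, h1, h | h⟩ <;> omega

theorem length_val_eq_sum (G : RLSLP α) {A : ℕ} (hA : G.children A ≠ []) :
    (G.val A).length = ((G.children A).map fun c => (G.val c).length).sum := by
  obtain ⟨c, hc⟩ := List.exists_mem_of_ne_nil _ hA
  rcases G.rule_cases (lt_numVars_of_mem_children hc) with ⟨a, -, h, -⟩ | ⟨h, -, -⟩
  · exact absurd h hA
  · rw [h, List.length_flatMap]

theorem val_ne_nil (G : RLSLP α) {A : ℕ} (hA : A < G.numVars) : G.val A ≠ [] := by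
  induction A using Nat.strong_induction_on with
  | _ A ih =>
  rcases G.rule_cases hA with ⟨a, h, -, -⟩ | ⟨h, h1, -⟩
  · simp [h]
  · obtain ⟨c, hc⟩ := List.exists_mem_of_length_pos (by omega : 0 < (G.children A).length)
    rw [h]
    intro h0
    exact ih c (children_lt hc) ((children_lt hc).trans hA) (List.flatMap_eq_nil_iff.1 h0 c hc)

theorem length_val_le_of_mem {G : RLSLP α} {A c : ℕ} (h : c ∈ G.children A) :
    (G.val c).length ≤ (G.val A).length := by
  rw [G.length_val_eq_sum (List.ne_nil_of_mem h)]
  exact List.single_le_sum (by simp) _ (List.mem_map_of_mem (f := fun c => (G.val c).length) h)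

/-- The number of occurrences of the variable `v` in the derivation tree of `A`. -/
def occ (G : RLSLP α) (v A : ℕ) : ℕ :=
  if A = v then 1 else ((G.children A).attach.map fun c => G.occ v c.1).sum
termination_by A
decreasing_by exact children_lt c.2

theorem occ_self (G : RLSLP α) (v : ℕ) : G.occ v v = 1 := by
  rw [occ, if_pos rfl]

theorem occ_of_ne (G : RLSLP α) {v A : ℕ} (h : A ≠ v) :
    G.occ v A = ((G.children A).map (G.occ v)).sum := by
  rw [occ, if_neg h, List.attach_map_val]

theorem occ_eq_zero_of_lt (G : RLSLP α) {v A : ℕ} (h : A < v) : G.occ v A = 0 := by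
  induction A using Nat.strong_induction_on with
  | _ A ih =>
  rw [occ_of_ne G h.ne, List.sum_eq_zero]
  intro x hx
  obtain ⟨c, hc, rfl⟩ := List.mem_map.1 hx
  exact ih c (children_lt hc) ((children_lt hc).trans h)

theorem occ_mul_length_le (G : RLSLP α) (v A : ℕ) :
    G.occ v A * (G.val v).length ≤ (G.val A).length := by
  induction A using Nat.strong_induction_on with
  | _ A ih =>
  by_cases h : A = v
  · rw [h, occ_self, one_mul]
  by_cases hc : G.children A = []
  · simp [occ_of_ne G h, hc]
  rw [occ_of_ne G h, G.length_val_eq_sum hc, ← List.sum_map_mul_right]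
  exact List.sum_le_sum fun c hc => ih c (children_lt hc)

theorem occ_le_occ_of_mem (G : RLSLP α) {u c : ℕ} (h : c ∈ G.children u) (A : ℕ) :
    G.occ u A ≤ G.occ c A := by
  induction A using Nat.strong_induction_on with
  | _ A ih =>
  have hcu := children_lt h
  by_cases h1 : A = u
  · subst h1
    rw [occ_self, occ_of_ne G hcu.ne', ← occ_self G c]
    exact List.single_le_sum (by simp) _ (List.mem_map_of_mem h)
  by_cases h2 : A = c
  · subst h2
    rw [occ_eq_zero_of_lt G hcu]
    exact Nat.zero_le _
  rw [occ_of_ne G h1, occ_of_ne G h2]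
  exact List.sum_le_sum fun x hx => ih x (children_lt hx)

/-- Occurrences of two different parents contain different occurrences of a common child. -/
theorem occ_add_occ_le (G : RLSLP α) {u v c : ℕ} (hu : c ∈ G.children u) (hv : c ∈ G.children v)
    (huv : u ≠ v) (A : ℕ) : G.occ u A + G.occ v A ≤ G.occ c A := by
  have at_parent : ∀ x y, c ∈ G.children x → c ∈ G.children y → x ≠ y →
      G.occ x x + G.occ y x ≤ G.occ c x := by
    intro x y hx hy hxy
    rw [occ_self, occ_of_ne G hxy, occ_of_ne G (children_lt hx).ne', add_comm]
    refine List.sum_lt_sum _ _ (fun z _ => G.occ_le_occ_of_mem hy z) ⟨c, hx, ?_⟩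
    rw [occ_self, occ_eq_zero_of_lt G (children_lt hy)]
    exact Nat.zero_lt_one
  induction A using Nat.strong_induction_on with
  | _ A ih =>
  by_cases h1 : A = u
  · rw [h1]; exact at_parent u v hu hv huv
  by_cases h2 : A = v
  · rw [h2, add_comm]; exact at_parent v u hv hu huv.symm
  by_cases h3 : A = c
  · rw [h3, occ_eq_zero_of_lt G (children_lt hu), occ_eq_zero_of_lt G (children_lt hv)]
    exact Nat.zero_le _
  rw [occ_of_ne G h1, occ_of_ne G h2, occ_of_ne G h3, ← List.sum_map_add]
  exact List.sum_le_sum fun x hx => ih x (children_lt hx)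

/-- The start variable. -/
def root (G : RLSLP α) : ℕ := G.numVars - 1

theorem root_lt (G : RLSLP α) : G.root < G.numVars := Nat.sub_lt G.numVars_pos Nat.one_pos

theorem val_root (G : RLSLP α) : G.val G.root = G.string := by
  rw [val, dif_pos G.root_lt]
  rfl

/-- A variable is used if it occurs in the derivation tree of the start variable. -/
def Used (G : RLSLP α) (v : ℕ) : Prop := 0 < G.occ v G.root

theorem Used.lt {G : RLSLP α} {v : ℕ} (h : G.Used v) : v < G.numVars := by
  by_contra hv
  rw [Used, occ_eq_zero_of_lt G (G.root_lt.trans_le (not_lt.1 hv))] at h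
  exact absurd h (lt_irrefl _)

theorem Used.child {G : RLSLP α} {v c : ℕ} (h : G.Used v) (hc : c ∈ G.children v) : G.Used c :=
  lt_of_lt_of_le h (G.occ_le_occ_of_mem hc _)

theorem used_root (G : RLSLP α) : G.Used G.root := by
  rw [Used, occ_self]; exact Nat.one_pos

theorem occ_root_le (G : RLSLP α) {v : ℕ} (h : G.Used v) :
    G.occ v G.root ≤ (G.val G.root).length := by
  have h1 := G.occ_mul_length_le v G.root
  have h2 : 1 ≤ (G.val v).length := List.length_pos_iff.2 (G.val_ne_nil h.lt)
  exact (Nat.le_mul_of_pos_right _ h2).trans h1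

/-! ### Symmetric centroid paths -/

/-- The level of a variable combines the logarithms of its length and of its number of
occurrences. It does not increase along the rules, and lies between `0` and twice the logarithm of
the length of the whole string. -/
def level (G : RLSLP α) (v : ℕ) : ℕ :=
  Nat.log 2 (G.val v).length +
    (Nat.log 2 (G.val G.root).length - Nat.log 2 (G.occ v G.root))

theorem level_root (G : RLSLP α) : G.level G.root = 2 * Nat.log 2 (G.val G.root).length := by
  rw [level, occ_self, Nat.log_one_right]; omega

theorem log_bounds_of_mem {G : RLSLP α} {v c : ℕ} (h : G.Used v) (hc : c ∈ G.children v) :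
    Nat.log 2 (G.val c).length ≤ Nat.log 2 (G.val v).length ∧
    Nat.log 2 (G.occ v G.root) ≤ Nat.log 2 (G.occ c G.root) ∧
    Nat.log 2 (G.occ c G.root) ≤ Nat.log 2 (G.val G.root).length :=
  ⟨Nat.log_mono_right (length_val_le_of_mem hc), Nat.log_mono_right (G.occ_le_occ_of_mem hc _),
    Nat.log_mono_right (G.occ_root_le (h.child hc))⟩

theorem level_le_of_mem {G : RLSLP α} {v c : ℕ} (h : G.Used v) (hc : c ∈ G.children v) :
    G.level c ≤ G.level v := by
  have := log_bounds_of_mem h hc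
  unfold level; omega

/-- The edges of the symmetric centroid paths: a variable and a child of the same level. -/
def Heavy (G : RLSLP α) (v c : ℕ) : Prop :=
  G.Used v ∧ c ∈ G.children v ∧ G.level c = G.level v

theorem Heavy.log_eq {G : RLSLP α} {v c : ℕ} (h : G.Heavy v c) :
    Nat.log 2 (G.val c).length = Nat.log 2 (G.val v).length ∧
      Nat.log 2 (G.occ c G.root) = Nat.log 2 (G.occ v G.root) := by
  obtain ⟨h1, h2, h3⟩ := h
  have := log_bounds_of_mem h1 h2
  unfold level at h3; omega

theorem log_lt_log_of_double_le {a b : ℕ} (ha : 0 < a) (h : a * 2 ≤ b) :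
    Nat.log 2 a < Nat.log 2 b := by
  have := Nat.log_mono_right (b := 2) h
  rw [Nat.log_mul_base (by norm_num) ha.ne'] at this
  omega

/-- A variable with two parents of the same level would occur twice as often as one of them. -/
theorem Heavy.parent_unique {G : RLSLP α} {u v c : ℕ} (hu : G.Heavy u c) (hv : G.Heavy v c) :
    u = v := by
  by_contra huv
  have h1 := G.occ_add_occ_le hu.2.1 hv.2.1 huv G.root
  have h2 := hu.log_eq.2
  have h3 := hv.log_eq.2
  have hu0 : 0 < G.occ u G.root := hu.1
  have hv0 : 0 < G.occ v G.root := hv.1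
  rcases le_total (G.occ u G.root) (G.occ v G.root) with h | h
  · have := log_lt_log_of_double_le hu0 (show G.occ u G.root * 2 ≤ G.occ c G.root by omega)
    omega
  · have := log_lt_log_of_double_le hv0 (show G.occ v G.root * 2 ≤ G.occ c G.root by omega)
    omega

/-- The siblings of a child of the same level have a smaller level, since the parent is at least
as long as any two of its children together. -/
theorem Heavy.exists_split {G : RLSLP α} {v c : ℕ} (h : G.Heavy v c) :
    ∃ l r, G.children v = l ++ c :: r ∧ ∀ x ∈ l ++ r, G.level x < G.level v := by
  obtain ⟨l, r, hlr⟩ := List.append_of_mem h.2.1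
  refine ⟨l, r, hlr, fun x hx => ?_⟩
  have hxv : x ∈ G.children v := by
    rw [hlr]; simp only [List.mem_append, List.mem_cons] at hx ⊢; tauto
  refine lt_of_le_of_ne (level_le_of_mem h.1 hxv) fun hne => ?_
  have hx2 : G.Heavy v x := ⟨h.1, hxv, hne⟩
  have hlen : (G.val c).length + (G.val x).length ≤ (G.val v).length := by
    rw [G.length_val_eq_sum (List.ne_nil_of_mem hxv), hlr]
    have : (G.val x).length ≤ ((l ++ r).map fun c => (G.val c).length).sum :=
      List.single_le_sum (by simp) _ (List.mem_map_of_mem (f := fun c => (G.val c).length) hx)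
    simp only [List.map_append, List.sum_append, List.map_cons, List.sum_cons] at this ⊢
    omega
  have h1 := h.log_eq.1
  have h2 := hx2.log_eq.1
  have hc0 : 0 < (G.val c).length :=
    List.length_pos_iff.2 (G.val_ne_nil (h.1.child h.2.1).lt)
  have hx0 : 0 < (G.val x).length :=
    List.length_pos_iff.2 (G.val_ne_nil (h.1.child hxv).lt)
  rcases le_total (G.val c).length (G.val x).length with h' | h'
  · have := log_lt_log_of_double_le hc0 (show (G.val c).length * 2 ≤ (G.val v).length by omega)
    omega
  · have := log_lt_log_of_double_le hx0 (show (G.val x).length * 2 ≤ (G.val v).length by omega)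
    omega

theorem Heavy.child_unique {G : RLSLP α} {v c d : ℕ} (hc : G.Heavy v c) (hd : G.Heavy v d) :
    c = d := by
  obtain ⟨l, r, hlr, h⟩ := hc.exists_split
  have hd2 := hd.2.1
  rw [hlr] at hd2
  by_contra hne
  have := h d (by simp only [List.mem_append, List.mem_cons] at hd2 ⊢; tauto)
  have := hd.2.2
  omega

open Classical in
/-- The variables on the symmetric centroid path below `v`, including `v`. -/
noncomputable def chain (G : RLSLP α) (v : ℕ) : Finset ℕ :=
  (Finset.range G.numVars).filter fun u => Relation.ReflTransGen G.Heavy v u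

theorem mem_chain {G : RLSLP α} {v u : ℕ} (hv : G.Used v) :
    u ∈ G.chain v ↔ Relation.ReflTransGen G.Heavy v u := by
  simp only [chain, Finset.mem_filter, Finset.mem_range, and_iff_right_iff_imp]
  intro h
  induction h with
  | refl => exact hv.lt
  | tail _ h _ => exact (children_lt h.2.1).trans h.1.lt

theorem chain_facts {G : RLSLP α} {v u : ℕ} (hv : G.Used v)
    (h : Relation.ReflTransGen G.Heavy v u) :
    G.Used u ∧ G.level u = G.level v ∧ u ≤ v ∧
      Nat.log 2 (G.val u).length = Nat.log 2 (G.val v).length := by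
  induction h with
  | refl => exact ⟨hv, rfl, le_rfl, rfl⟩
  | tail _ h ih =>
    exact ⟨h.1.child h.2.1, h.2.2.trans ih.2.1, (children_lt h.2.1).le.trans ih.2.2.1,
      h.log_eq.1.trans ih.2.2.2⟩

theorem chain_eq_insert {G : RLSLP α} {v c : ℕ} (h : G.Heavy v c) :
    G.chain v = insert v (G.chain c) ∧ v ∉ G.chain c := by
  constructor
  · ext u
    rw [mem_chain h.1, Finset.mem_insert, mem_chain (h.1.child h.2.1),
      Relation.ReflTransGen.cases_head_iff]
    refine or_congr eq_comm ⟨?_, fun hu => ⟨c, h, hu⟩⟩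
    rintro ⟨d, hd, hu⟩
    rwa [h.child_unique hd]
  · intro hv
    rw [mem_chain (h.1.child h.2.1)] at hv
    have := (chain_facts (h.1.child h.2.1) hv).2.2.1
    have := children_lt h.2.1
    omega

theorem chain_eq_singleton {G : RLSLP α} {v : ℕ} (hv : G.Used v) (h : ∀ c, ¬ G.Heavy v c) :
    G.chain v = {v} := by
  ext u
  rw [mem_chain hv, Finset.mem_singleton, Relation.ReflTransGen.cases_head_iff]
  constructor
  · rintro (h1 | ⟨c, hc, -⟩)
    · exact h1.symm
    · exact absurd hc (h c)
  · exact fun h => Or.inl h.symm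

/-- A variable at which a symmetric centroid path starts. -/
def IsHead (G : RLSLP α) (v : ℕ) : Prop := G.Used v ∧ ∀ u, ¬ G.Heavy u v

theorem exists_head {G : RLSLP α} {v : ℕ} (hv : G.Used v) :
    ∃ h, G.IsHead h ∧ v ∈ G.chain h := by
  induction hn : G.numVars - v using Nat.strong_induction_on generalizing v with
  | _ n ih =>
  by_cases h : ∃ u, G.Heavy u v
  · obtain ⟨u, hu⟩ := h
    have h1 := children_lt hu.2.1
    have h2 := hv.lt
    obtain ⟨x, hx, hux⟩ := ih (G.numVars - u) (by omega) hu.1 rfl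
    rw [mem_chain hx.1] at hux
    exact ⟨x, hx, (mem_chain hx.1).2 (hux.tail hu)⟩
  · exact ⟨v, ⟨hv, not_exists.1 h⟩, (mem_chain hv).2 .refl⟩

theorem head_unique {G : RLSLP α} {g h v : ℕ} (hg : G.IsHead g) (hh : G.IsHead h)
    (hgv : v ∈ G.chain g) (hhv : v ∈ G.chain h) : g = h := by
  rw [mem_chain hg.1] at hgv
  rw [mem_chain hh.1] at hhv
  induction hgv with
  | refl =>
    rcases Relation.ReflTransGen.cases_tail_iff _ _ _ |>.1 hhv with h1 | ⟨u, -, hu⟩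
    · exact h1
    · exact absurd hu (hg.2 u)
  | tail _ hb ih =>
    rcases Relation.ReflTransGen.cases_tail_iff _ _ _ |>.1 hhv with h1 | ⟨u, hu, huv⟩
    · subst h1
      exact absurd hb (hh.2 _)
    · exact ih (by rwa [hb.parent_unique huv])

end RLSLP

/-! ### Balancing a grammar -/

namespace RLSLP

variable {G : RLSLP ℕ}

/-- The trees `τ`, with all nodes in `F`, derive the same strings as the variables of level less
than `k`, and they have logarithmic height. -/
def Balanced (G : RLSLP ℕ) (k : ℕ) (τ : ℕ → RLTree) (F : Finset RLTree) : Prop :=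
  ∀ v, G.Used v → G.level v < k → (τ v).str = G.val v ∧
    (τ v).height ≤ 4 * Nat.log 2 (G.val v).length + 9 * (G.level v + 1) ∧ (τ v).subterms ⊆ F

open RLTree in
theorem Balanced.items {k : ℕ} {τ : ℕ → RLTree} {F : Finset RLTree} (hτ : G.Balanced k τ F)
    {l : List ℕ} (hl : ∀ x ∈ l, G.Used x ∧ G.level x < k) :
    (l.map τ).flatMap str = l.flatMap G.val ∧
      ∀ X ∈ l.map τ, X.subterms ⊆ F ∧ X.height ≤ 4 * Nat.log 2 X.len + 9 * k := by
  constructor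
  · rw [List.flatMap_map, List.flatMap, List.flatMap]
    congr 1
    exact List.map_congr_left fun x hx => (hτ x (hl x hx).1 (hl x hx).2).1
  · intro X hX
    obtain ⟨x, hx, rfl⟩ := List.mem_map.1 hX
    obtain ⟨h1, h2, h3⟩ := hτ x (hl x hx).1 (hl x hx).2
    have := (hl x hx).2
    rw [← h1, length_str] at h2
    exact ⟨h3, by omega⟩

open RLTree in
/-- The items hanging to the left and to the right of a symmetric centroid path: a variable on the
path derives a suffix of the former followed by a prefix of the latter. The children of the last
variable count as left items; if its rule is a terminal or a power, then one new node stands for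
it. -/
theorem exists_path_items {k : ℕ} {τ : ℕ → RLTree} {F : Finset RLTree}
    (hτ : G.Balanced k τ F) {v : ℕ} (hv : G.Used v) (hk : G.level v = k) :
    ∃ (Ls Rs : List RLTree) (E : Finset RLTree), E.card ≤ 1 ∧
      Ls.length + Rs.length ≤ ∑ u ∈ G.chain v, G.ruleSize u ∧
      (∀ X ∈ Ls ++ Rs, X.subterms ⊆ E ∪ F ∧ X.height ≤ 4 * Nat.log 2 X.len + 9 * k) ∧
      G.val v = Ls.flatMap str ++ Rs.flatMap str ∧
      ∀ u ∈ G.chain v, ∃ L R, L <:+ Ls ∧ R <+: Rs ∧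
        G.val u = L.flatMap str ++ R.flatMap str := by
  induction v using Nat.strong_induction_on with
  | _ v ih =>
  by_cases hc : ∃ c, G.Heavy v c
  · obtain ⟨c, hc⟩ := hc
    have hcu := hv.child hc.2.1
    obtain ⟨Ls, Rs, E, h1, h2, h3, h4, h5⟩ := ih c (children_lt hc.2.1) hcu (hc.2.2.trans hk)
    obtain ⟨l, r, hlr, hlt⟩ := hc.exists_split
    have hl : ∀ x ∈ l ++ r, G.Used x ∧ G.level x < k := fun x hx =>
      ⟨hv.child (by rw [hlr]; simp only [List.mem_append, List.mem_cons] at hx ⊢; tauto),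
        hk ▸ hlt x hx⟩
    obtain ⟨hlv, hl⟩ := hτ.items (l := l) fun x hx => hl x (List.mem_append_left _ hx)
    obtain ⟨hrv, hr⟩ := hτ.items (l := r) fun x hx => by
      refine ⟨hv.child (by simp [hlr, hx]), hk ▸ hlt x (by simp [hx])⟩
    have hval : G.val v = (l.map τ ++ Ls).flatMap str ++ (Rs ++ r.map τ).flatMap str := by
      rcases G.rule_cases hv.lt with ⟨a, -, h, -⟩ | ⟨h, -, -⟩
      · rw [h] at hlr; simp at hlr
      · rw [h, hlr]
        simp only [List.flatMap_append, List.flatMap_cons, hlv, hrv, h4, List.append_assoc]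
    have hsz : l.length + r.length ≤ G.ruleSize v := by
      rcases G.rule_cases hv.lt with ⟨a, -, h, -⟩ | ⟨-, -, h | ⟨h, B, t, ht, hB⟩⟩
      · rw [h] at hlr; simp at hlr
      · rw [h, hlr]; simp only [List.length_append, List.length_cons]; omega
      -- All copies of a power have the same level, so none of them continues the path.
      · exfalso
        have hall : ∀ x ∈ G.children v, x = c := by
          rw [hB]
          intro x hx
          have hcB := hc.2.1
          rw [hB] at hcB
          rw [List.eq_of_mem_replicate hx, List.eq_of_mem_replicate hcB]
        have hlen : 0 < (l ++ r).length := by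
          have := congrArg List.length hlr
          rw [hB] at this
          simp only [List.length_replicate, List.length_append, List.length_cons] at this ⊢
          omega
        obtain ⟨x, hx⟩ := List.exists_mem_of_length_pos hlen
        have h6 := hlt x hx
        rw [hall x (by rw [hlr]; simp only [List.mem_append, List.mem_cons] at hx ⊢; tauto),
          hc.2.2] at h6
        exact absurd h6 (lt_irrefl _)
    obtain ⟨hch, hnot⟩ := chain_eq_insert hc
    refine ⟨l.map τ ++ Ls, Rs ++ r.map τ, E, h1, ?_, ?_, hval, ?_⟩
    · rw [hch, Finset.sum_insert hnot]
      simp only [List.length_append, List.length_map]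
      omega
    · intro X hX
      have hFE : ∀ X : RLTree, X.subterms ⊆ F → X.subterms ⊆ E ∪ F := fun X h =>
        h.trans Finset.subset_union_right
      simp only [List.mem_append] at hX
      rcases hX with (h | h) | (h | h)
      · exact ⟨hFE X (hl X h).1, (hl X h).2⟩
      · exact h3 X (by simp [h])
      · exact h3 X (by simp [h])
      · exact ⟨hFE X (hr X h).1, (hr X h).2⟩
    · intro u hu
      rw [hch, Finset.mem_insert] at hu
      rcases hu with rfl | hu
      · exact ⟨_, _, List.suffix_refl _, List.prefix_refl _, hval⟩
      · obtain ⟨L, R, hL, hR, huv⟩ := h5 u hu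
        exact ⟨L, R, hL.trans (List.suffix_append _ _), hR.trans (List.prefix_append _ _), huv⟩
  · have hcs := chain_eq_singleton hv (not_exists.1 hc)
    have hch : ∀ x ∈ G.children v, G.Used x ∧ G.level x < k := fun x hx =>
      ⟨hv.child hx, hk ▸ lt_of_le_of_ne (level_le_of_mem hv hx) fun h =>
        hc ⟨x, hv, hx, h⟩⟩
    obtain ⟨hiv, hit⟩ := hτ.items hch
    -- It suffices to give the items of `v` alone.
    suffices h : ∃ (Ls : List RLTree) (E : Finset RLTree), E.card ≤ 1 ∧
        Ls.length ≤ G.ruleSize v ∧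
        (∀ X ∈ Ls, X.subterms ⊆ E ∪ F ∧ X.height ≤ 4 * Nat.log 2 X.len + 9 * k) ∧
        G.val v = Ls.flatMap str by
      obtain ⟨Ls, E, h1, h2, h3, h4⟩ := h
      refine ⟨Ls, [], E, h1, by simpa [hcs] using h2, by simpa using h3, by simpa using h4, ?_⟩
      intro u hu
      rw [hcs, Finset.mem_singleton] at hu
      exact ⟨Ls, [], List.suffix_refl _, List.prefix_refl _, by rw [hu]; simpa using h4⟩
    rcases G.rule_cases hv.lt with ⟨a, h1, -, h2⟩ | ⟨h1, h2, h3 | ⟨h3, B, t, ht, hB⟩⟩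
    · refine ⟨[leaf a], {leaf a}, by simp, by simp [h2], ?_, by simp [h1, str]⟩
      intro X hX
      rw [List.mem_singleton] at hX
      subst hX
      exact ⟨by simp [subterms], by simp [height]⟩
    · refine ⟨(G.children v).map τ, ∅, by simp, by simp [h3], ?_, h1.trans hiv.symm⟩
      intro X hX
      exact ⟨(hit X hX).1.trans Finset.subset_union_right, (hit X hX).2⟩
    · have hBmem : B ∈ G.children v := by
        rw [hB]; exact List.mem_replicate.2 ⟨by omega, rfl⟩
      obtain ⟨hB1, hB2⟩ := hch B hBmem
      obtain ⟨h4, h5, h6⟩ := hτ B hB1 hB2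
      refine ⟨[pow (τ B) (t - 1)], {pow (τ B) (t - 1)}, by simp, by simp [h3], ?_, ?_⟩
      · intro X hX
        rw [List.mem_singleton] at hX
        subst hX
        refine ⟨?_, ?_⟩
        · intro y hy
          simp only [subterms, Finset.mem_insert] at hy
          rcases hy with rfl | hy
          · simp
          · exact Finset.mem_union_right _ (h6 hy)
        · have hlog : Nat.log 2 (τ B).len < Nat.log 2 (pow (τ B) (t - 1)).len := by
            refine log_lt_log_of_double_le (len_pos _) ?_
            rw [len, mul_comm]
            exact Nat.mul_le_mul_right _ (by omega)
          rw [← h4, length_str] at h5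
          simp only [height]
          omega
      · rw [h1, hB]
        simp only [List.flatMap_cons, List.flatMap_nil, List.append_nil, str, h4]
        rw [show t - 1 + 1 = t by omega, List.flatMap, List.map_replicate]

open RLTree in
/-- Balanced trees for all variables on one symmetric centroid path. -/
theorem exists_balanced_path {k : ℕ} {τ : ℕ → RLTree} {F : Finset RLTree}
    (hτ : G.Balanced k τ F) {h : ℕ} (hh : G.Used h) (hk : G.level h = k) :
    ∃ (σ : ℕ → RLTree) (D : Finset RLTree),
      D.card ≤ 86 * ∑ u ∈ G.chain h, G.ruleSize u ∧
      ∀ u ∈ G.chain h, (σ u).str = G.val u ∧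
        (σ u).height ≤ 4 * Nat.log 2 (G.val u).length + 9 * (G.level u + 1) ∧
        (σ u).subterms ⊆ D ∪ F := by
  obtain ⟨Ls, Rs, E, h1, h2, h3, h4, h5⟩ := exists_path_items hτ hh hk
  set K := (G.val h).length with hK
  have hlen : (Ls.map len).sum + (Rs.map len).sum = K := by
    rw [hK, h4, List.length_append, List.length_flatMap, List.length_flatMap]
    simp only [length_str]
  have hB : ∀ X ∈ Ls ++ Rs, X.height + 4 * (Nat.log 2 K - Nat.log 2 X.len) ≤
      4 * Nat.log 2 K + 9 * k := by
    intro X hX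
    have h6 := (h3 X hX).2
    have h7 : X.len ≤ K := by
      rw [← hlen, ← List.sum_append, ← List.map_append]
      exact List.single_le_sum (by simp) _ (List.mem_map_of_mem hX)
    have := Nat.log_mono_right (b := 2) h7
    omega
  obtain ⟨FL, hFL, hsuf⟩ := exists_suffix_trees (E ∪ F) Ls (fun X hX => (h3 X (by simp [hX])).1) K
    (by omega) (4 * Nat.log 2 K + 9 * k) fun X hX => hB X (by simp [hX])
  obtain ⟨FR, hFR, hpre⟩ := exists_prefix_trees (E ∪ F) Rs (fun X hX => (h3 X (by simp [hX])).1) K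
    (by omega) (4 * Nat.log 2 K + 9 * k) fun X hX => hB X (by simp [hX])
  have hσ : ∀ u, ∃ t : RLTree, u ∈ G.chain h → t.str = G.val u ∧
      t.height ≤ 4 * Nat.log 2 K + 9 * k + 8 ∧
      t.subterms ⊆ insert t (FL ∪ FR ∪ E) ∪ F := by
    intro u
    by_cases hu : u ∈ G.chain h
    · obtain ⟨L, R, hL, hR, huv⟩ := h5 u hu
      by_cases hL0 : L = []
      · have hR0 : R ≠ [] := by
          rintro rfl
          refine G.val_ne_nil (chain_facts hh ((mem_chain hh).1 hu)).1.lt ?_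
          simpa [hL0] using huv
        obtain ⟨t, ht1, ht2, ht3⟩ := hpre R hR hR0
        refine ⟨t, fun _ => ⟨by simp [huv, hL0, ht1], by omega, ht3.trans ?_⟩⟩
        intro x; simp only [Finset.mem_union, Finset.mem_insert]; tauto
      · obtain ⟨s, hs1, hs2, hs3⟩ := hsuf L hL hL0
        by_cases hR0 : R = []
        · refine ⟨s, fun _ => ⟨by simp [huv, hR0, hs1], by omega, hs3.trans ?_⟩⟩
          intro x; simp only [Finset.mem_union, Finset.mem_insert]; tauto
        · obtain ⟨t, ht1, ht2, ht3⟩ := hpre R hR hR0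
          refine ⟨pair s t, fun _ => ⟨by rw [huv, str, hs1, ht1],
            by simp only [height]; omega, ?_⟩⟩
          intro x hx
          simp only [subterms, Finset.mem_insert, Finset.mem_union] at hx ⊢
          rcases hx with h | h | h
          · tauto
          · have := hs3 h
            simp only [Finset.mem_union] at this; tauto
          · have := ht3 h
            simp only [Finset.mem_union] at this; tauto
    · exact ⟨leaf 0, fun h => absurd h hu⟩
  choose σ hσ using hσ
  refine ⟨σ, FL ∪ FR ∪ E ∪ (G.chain h).image σ, ?_, ?_⟩
  · have h6 := Finset.card_union_le (FL ∪ FR ∪ E) ((G.chain h).image σ)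
    have h7 := Finset.card_union_le (FL ∪ FR) E
    have h8 := Finset.card_union_le FL FR
    have h9 : ((G.chain h).image σ).card ≤ (G.chain h).card := Finset.card_image_le
    have h10 : (G.chain h).card ≤ ∑ u ∈ G.chain h, G.ruleSize u := by
      rw [Finset.card_eq_sum_ones]
      exact Finset.sum_le_sum fun u hu =>
        G.ruleSize_pos (chain_facts hh ((mem_chain hh).1 hu)).1.lt
    have h11 : 1 ≤ (G.chain h).card := Finset.card_pos.2 ⟨h, (mem_chain hh).2 .refl⟩
    omega
  · intro u hu
    obtain ⟨h6, h7, h8⟩ := hσ u hu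
    obtain ⟨-, h9, -, h10⟩ := chain_facts hh ((mem_chain hh).1 hu)
    refine ⟨h6, by rw [h9, h10, hk, ← hK]; omega, h8.trans ?_⟩
    have : σ u ∈ (G.chain h).image σ := Finset.mem_image_of_mem σ hu
    intro x hx
    simp only [Finset.mem_union, Finset.mem_insert] at hx ⊢
    rcases hx with (rfl | hx) | hx <;> tauto

open Classical in
/-- Induction on the level: the items of a path of level `k` have levels below `k`, and the paths of
level `k` are disjoint, so their sizes add up. -/
theorem exists_balanced (G : RLSLP ℕ) (k : ℕ) : ∃ (τ : ℕ → RLTree) (F : Finset RLTree),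
    G.Balanced k τ F ∧
    F.card ≤ 86 * ∑ u ∈ (Finset.range G.numVars).filter (fun u => G.Used u ∧ G.level u < k),
      G.ruleSize u := by
  induction k with
  | zero => exact ⟨fun _ => .leaf 0, ∅, fun v _ h => absurd h (Nat.not_lt_zero _), by simp⟩
  | succ k ih =>
    obtain ⟨τ, F, hτ, hF⟩ := ih
    set H := (Finset.range G.numVars).filter fun h => G.IsHead h ∧ G.level h = k with hH
    have hHmem : ∀ h ∈ H, G.IsHead h ∧ G.level h = k := fun h hh => (Finset.mem_filter.1 hh).2
    have hpath : ∀ h, ∃ (σ : ℕ → RLTree) (D : Finset RLTree), h ∈ H →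
        D.card ≤ 86 * ∑ u ∈ G.chain h, G.ruleSize u ∧
        ∀ u ∈ G.chain h, (σ u).str = G.val u ∧
          (σ u).height ≤ 4 * Nat.log 2 (G.val u).length + 9 * (G.level u + 1) ∧
          (σ u).subterms ⊆ D ∪ F := by
      intro h
      by_cases hh : h ∈ H
      · obtain ⟨σ, D, h1⟩ := exists_balanced_path hτ (hHmem h hh).1.1 (hHmem h hh).2
        exact ⟨σ, D, fun _ => h1⟩
      · exact ⟨fun _ => .leaf 0, ∅, fun h => absurd h hh⟩
    choose σ D hσD using hpath
    have hhead : ∀ v, ∃ h, G.Used v → G.IsHead h ∧ v ∈ G.chain h := by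
      intro v
      by_cases hv : G.Used v
      · obtain ⟨h, hh⟩ := exists_head hv
        exact ⟨h, fun _ => hh⟩
      · exact ⟨0, fun h => absurd h hv⟩
    choose hd hhd using hhead
    refine ⟨fun v => if G.level v < k then τ v else σ (hd v) v, F ∪ H.biUnion D, ?_, ?_⟩
    · intro v hv hvk
      by_cases hlt : G.level v < k
      · simp only [hlt, if_true]
        obtain ⟨h1, h2, h3⟩ := hτ v hv hlt
        exact ⟨h1, h2, h3.trans Finset.subset_union_left⟩
      · simp only [hlt, if_false]
        obtain ⟨h1, h2⟩ := hhd v hv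
        have h3 := chain_facts h1.1 ((mem_chain h1.1).1 h2)
        have h4 : hd v ∈ H := by
          rw [hH, Finset.mem_filter, Finset.mem_range]
          exact ⟨h1.1.lt, h1, by omega⟩
        obtain ⟨h5, h6, h7⟩ := (hσD (hd v) h4).2 v h2
        refine ⟨h5, h6, h7.trans (Finset.union_subset ?_ Finset.subset_union_left)⟩
        exact (Finset.subset_biUnion_of_mem D h4).trans Finset.subset_union_right
    · have hcard : (H.biUnion D).card ≤ 86 * ∑ u ∈ H.biUnion G.chain, G.ruleSize u := by
        rw [Finset.sum_biUnion, Finset.mul_sum]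
        · exact Finset.card_biUnion_le.trans (Finset.sum_le_sum fun h hh => (hσD h hh).1)
        · intro g hg h hh hgh
          refine Finset.disjoint_left.2 fun v hvg hvh => hgh ?_
          exact head_unique (hHmem g hg).1 (hHmem h hh).1 hvg hvh
      have hdisj : Disjoint
          ((Finset.range G.numVars).filter fun u => G.Used u ∧ G.level u < k)
          (H.biUnion G.chain) := by
        refine Finset.disjoint_left.2 fun v hv hv' => ?_
        obtain ⟨h, hh, hvh⟩ := Finset.mem_biUnion.1 hv'
        have h1 := (hHmem h hh).1.1
        have h2 := chain_facts h1 ((mem_chain h1).1 hvh)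
        have h3 := (Finset.mem_filter.1 hv).2.2
        have h4 := (hHmem h hh).2
        omega
      have hsub : ((Finset.range G.numVars).filter fun u => G.Used u ∧ G.level u < k) ∪
          H.biUnion G.chain ⊆
          (Finset.range G.numVars).filter fun u => G.Used u ∧ G.level u < k + 1 := by
        intro v hv
        rw [Finset.mem_filter, Finset.mem_range]
        rcases Finset.mem_union.1 hv with hv | hv
        · have h1 := (Finset.mem_filter.1 hv).2
          exact ⟨h1.1.lt, h1.1, by omega⟩
        · obtain ⟨h, hh, hvh⟩ := Finset.mem_biUnion.1 hv
          have h1 := (hHmem h hh).1.1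
          have h2 := chain_facts h1 ((mem_chain h1).1 hvh)
          have h4 := (hHmem h hh).2
          exact ⟨h2.1.lt, h2.1, by omega⟩
      have hsum := Finset.sum_le_sum_of_subset (f := G.ruleSize) hsub
      rw [Finset.sum_union hdisj] at hsum
      have := Finset.card_union_le F (H.biUnion D)
      omega

/-- Every run-length straight-line program can be balanced: the string it generates has a
derivation tree of logarithmic height whose number of distinct subtrees is linear in the size of
the program. -/
theorem exists_balanced_tree (G : RLSLP ℕ) : ∃ t : RLTree, t.str = G.string ∧
    t.height ≤ 22 * Nat.log 2 G.string.length + 9 ∧ t.subterms.card ≤ 86 * G.size := by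
  classical
  obtain ⟨τ, F, hτ, hF⟩ := G.exists_balanced (G.level G.root + 1)
  obtain ⟨h1, h2, h3⟩ := hτ G.root G.used_root (Nat.lt_succ_self _)
  refine ⟨τ G.root, by rw [h1, val_root], ?_, (Finset.card_le_card h3).trans (hF.trans ?_)⟩
  · rw [level_root, val_root] at h2
    omega
  · refine Nat.mul_le_mul_left _ ?_
    calc _ ≤ ∑ u ∈ Finset.range G.numVars, G.ruleSize u :=
          Finset.sum_le_sum_of_subset (Finset.filter_subset _ _)
      _ = ∑ A : Fin G.numVars, G.ruleSize A := (Fin.sum_univ_eq_sum_range _ _).symm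
      _ = G.size := by
        rw [size]
        exact Finset.sum_congr rfl fun A _ => by simp [ruleSize]

end RLSLP

/-! ### Searching in a tree without a stack -/

/-- The position `j` (counted from `1`) carries the last symbol of `s` that satisfies `ok`, and
this symbol is `a`. -/
def LastOk (ok : ℕ → Bool) (s : List ℕ) (j a : ℕ) : Prop :=
  ∃ x y, s = x ++ a :: y ∧ x.length + 1 = j ∧ ok a = true ∧ ∀ b ∈ y, ok b = false

theorem LastOk.append_left {ok : ℕ → Bool} {s : List ℕ} {j a : ℕ} (h : LastOk ok s j a)
    (u : List ℕ) : LastOk ok (u ++ s) (u.length + j) a := by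
  obtain ⟨x, y, rfl, rfl, h1, h2⟩ := h
  exact ⟨u ++ x, y, by simp, by simp; omega, h1, h2⟩

theorem LastOk.append_right {ok : ℕ → Bool} {s : List ℕ} {j a : ℕ} (h : LastOk ok s j a)
    {u : List ℕ} (hu : ∀ b ∈ u, ok b = false) : LastOk ok (s ++ u) j a := by
  obtain ⟨x, y, rfl, rfl, h1, h2⟩ := h
  refine ⟨x, y ++ u, by simp, rfl, h1, fun b hb => ?_⟩
  rcases List.mem_append.1 hb with hb | hb
  · exact h2 b hb
  · exact hu b hb

namespace RLTree

/-- The search for the last symbol satisfying `ok` among the first `m` symbols of `t`, an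
occurrence of which starts after position `off`; the first argument bounds the number of
iterations. The search descends towards position `m`. Instead of a stack it keeps one candidate,
the last tree seen to end before position `m` that contains a suitable symbol, together with its
offset. The result is a position (`0` if there is none) and the symbol there. -/
def search (ok : ℕ → Bool) : ℕ → RLTree → ℕ → ℕ → Option (RLTree × ℕ) → Option (ℕ × ℕ)
  | 0, _, _, _, _ => none
  | k + 1, t, m, off, cand =>
    if ok t.minSym then
      match t with
      | leaf a => some (off + 1, a)
      | pair l r =>
        if m ≤ l.len then search ok k l m off cand
        else search ok k r (m - l.len) (off + l.len) (if ok l.minSym then some (l, off) else cand)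
      | pow s _ =>
        search ok k s (m - (m - 1) / s.len * s.len) (off + (m - 1) / s.len * s.len)
          (if (m - 1) / s.len = 0 then cand
            else some (s, off + (m - 1) / s.len * s.len - s.len))
    else
      match cand with
      | none => some (0, 0)
      | some (c, o) => search ok k c c.len o none

/-- What is left of the search after a failed descent. -/
def searchFail (ok : ℕ → Bool) (k : ℕ) : Option (RLTree × ℕ) → Option (ℕ × ℕ)
  | none => some (0, 0)
  | some (c, o) => search ok k c c.len o none

theorem search_of_not_ok {ok : ℕ → Bool} {t : RLTree} (h : ok t.minSym = false) (k m off : ℕ)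
    (cand : Option (RLTree × ℕ)) :
    search ok (k + 1) t m off cand = searchFail ok k cand := by
  rw [search.eq_def]
  simp only [h, Bool.false_eq_true, if_false]
  cases cand <;> rfl

theorem forall_not_ok_of_minSym {ok : ℕ → Bool} (hok : ∀ a b, a ≤ b → ok b = true → ok a = true)
    {t : RLTree} (h : ok t.minSym = false) : ∀ b ∈ t.str, ok b = false := by
  intro b hb
  by_contra hne
  rw [hok _ b (minSym_le hb) (by simpa using hne)] at h
  exact absurd h (by simp)

theorem take_pow_str {s : RLTree} {k m : ℕ} (h1 : 1 ≤ m) (h2 : m ≤ (pow s k).len) :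
    (pow s k).str.take m = (List.replicate ((m - 1) / s.len) s.str).flatten ++
      s.str.take (m - (m - 1) / s.len * s.len) ∧ 1 ≤ m - (m - 1) / s.len * s.len ∧
      m - (m - 1) / s.len * s.len ≤ s.len ∧ (m - 1) / s.len ≤ k := by
  have hl := s.len_pos
  set q := (m - 1) / s.len with hq
  have h3 : q * s.len ≤ m - 1 := Nat.div_mul_le_self _ _
  have h4 : m - 1 < (q + 1) * s.len := by
    have := Nat.lt_mul_div_succ (m - 1) hl
    rwa [mul_comm] at this
  have h5 : q ≤ k := by
    rw [len] at h2
    have : q < k + 1 := by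
      rw [hq, Nat.div_lt_iff_lt_mul hl]; omega
    omega
  rw [Nat.add_mul, one_mul] at h4
  refine ⟨?_, by omega, by omega, h5⟩
  obtain ⟨c, hc⟩ := Nat.exists_eq_add_of_le h5
  rw [str, show k + 1 = q + (c + 1) by omega, List.replicate_add, List.flatten_append,
    List.replicate_succ (n := c), List.flatten_cons]
  have h6 : (List.replicate q s.str).flatten.length = q * s.len := by simp
  rw [List.take_append, h6, List.take_of_length_le (by rw [h6]; omega),
    List.take_append_of_le_length (by rw [length_str]; omega)]

/-- The descent towards position `m` either succeeds, or ends with the old candidate and no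
suitable symbol, or ends with a candidate that contains the answer. -/
theorem search_descent {ok : ℕ → Bool} (hok : ∀ a b, a ≤ b → ok b = true → ok a = true)
    (t : RLTree) (m off : ℕ) (cand : Option (RLTree × ℕ)) (h1 : 1 ≤ m) (h2 : m ≤ t.len) :
    ∃ k ≤ t.height + 1,
      (∃ j a, LastOk ok (t.str.take m) j a ∧
        ∀ f, search ok (k + f) t m off cand = some (off + j, a)) ∨
      ((∀ b ∈ t.str.take m, ok b = false) ∧
        ∀ f, search ok (k + f) t m off cand = searchFail ok f cand) ∨
      (∃ c o, off ≤ o ∧ ok c.minSym = true ∧ c.height < t.height ∧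
        (∀ j a, LastOk ok c.str j a → LastOk ok (t.str.take m) (o - off + j) a) ∧
        ∀ f, search ok (k + f) t m off cand = searchFail ok f (some (c, o))) := by
  induction t generalizing m off cand with
  | leaf a =>
    simp only [len] at h2
    obtain rfl : m = 1 := by omega
    refine ⟨1, by simp [height], ?_⟩
    by_cases ha : ok a = true
    · refine Or.inl ⟨1, a, ⟨[], [], by simp [str], rfl, ha, by simp⟩, fun f => ?_⟩
      rw [add_comm, search.eq_def]
      simp [minSym, ha]
    · have ha' : ok a = false := by simpa using ha
      refine Or.inr (Or.inl ⟨by simp [str, ha'], fun f => ?_⟩)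
      rw [add_comm, search_of_not_ok ha']
  | pair l r hl hr =>
    by_cases hmin : ok (pair l r).minSym = true
    · by_cases hm : m ≤ l.len
      · have htake : (pair l r).str.take m = l.str.take m := by
          rw [str, List.take_append_of_le_length (by rw [length_str]; exact hm)]
        have hstep : ∀ f, search ok (f + 1) (pair l r) m off cand = search ok f l m off cand := by
          intro f
          rw [search.eq_def]
          simp only [hmin, if_true, hm]
        obtain ⟨k, hk, h⟩ := hl m off cand h1 hm
        refine ⟨k + 1, by simp only [height]; omega, ?_⟩
        rw [htake]
        have hk1 : ∀ f, k + 1 + f = k + f + 1 := fun f => by omega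
        simp only [hk1, hstep]
        refine h.imp_right (Or.imp_right ?_)
        rintro ⟨c, o, h3, h4, h5, h6⟩
        exact ⟨c, o, h3, h4, by simp only [height]; omega, h6⟩
      · have htake : (pair l r).str.take m = l.str ++ r.str.take (m - l.len) := by
          rw [str, List.take_append, length_str,
            List.take_of_length_le (by rw [length_str]; omega)]
        simp only [len] at h2
        set cand' := if ok l.minSym then some (l, off) else cand with hcand'
        have hstep : ∀ f, search ok (f + 1) (pair l r) m off cand =
            search ok f r (m - l.len) (off + l.len) cand' := by
          intro f
          rw [search.eq_def]
          simp only [hmin, if_true, hm, if_false, hcand']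
        obtain ⟨k, hk, h⟩ := hr (m - l.len) (off + l.len) cand' (by omega) (by omega)
        refine ⟨k + 1, by simp only [height]; omega, ?_⟩
        rw [htake]
        have hk1 : ∀ f, k + 1 + f = k + f + 1 := fun f => by omega
        simp only [hk1, hstep]
        rcases h with ⟨j, a, h3, h4⟩ | ⟨h3, h4⟩ | ⟨c, o, h3, h4, h5, h6, h7⟩
        · refine Or.inl ⟨l.len + j, a, ?_, fun f => by rw [h4, add_assoc]⟩
          simpa using h3.append_left l.str
        · by_cases hlmin : ok l.minSym = true
          · refine Or.inr (Or.inr ⟨l, off, le_rfl, hlmin, by simp only [height]; omega,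
              fun j a hj => ?_, fun f => by rw [h4, hcand', if_pos hlmin]⟩)
            simpa using hj.append_right h3
          · have hlmin' : ok l.minSym = false := by simpa using hlmin
            refine Or.inr (Or.inl ⟨fun b hb => ?_, fun f => by rw [h4, hcand', if_neg hlmin]⟩)
            rcases List.mem_append.1 hb with hb | hb
            · exact forall_not_ok_of_minSym hok hlmin' b hb
            · exact h3 b hb
        · refine Or.inr (Or.inr ⟨c, o, by omega, h4, by simp only [height]; omega,
            fun j a hj => ?_, h7⟩)
          have := (h6 j a hj).append_left l.str
          rw [length_str] at this
          rwa [show o - off + j = l.len + (o - (off + l.len) + j) by omega]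
    · have hmin' : ok (pair l r).minSym = false := by simpa using hmin
      refine ⟨1, by omega, Or.inr (Or.inl ⟨fun b hb => ?_, fun f => ?_⟩)⟩
      · exact forall_not_ok_of_minSym hok hmin' b (List.mem_of_mem_take hb)
      · rw [add_comm, search_of_not_ok hmin']
  | pow s n ih =>
    by_cases hmin : ok (pow s n).minSym = true
    · obtain ⟨htake, hm1, hm2, -⟩ := take_pow_str h1 h2
      have hl := s.len_pos
      have hstep : ∀ f, search ok (f + 1) (pow s n) m off cand =
          search ok f s (m - (m - 1) / s.len * s.len) (off + (m - 1) / s.len * s.len)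
          (if (m - 1) / s.len = 0 then cand
            else some (s, off + (m - 1) / s.len * s.len - s.len)) := by
        intro f
        rw [search.eq_def]
        simp only [hmin, if_true]
      set q := (m - 1) / s.len
      set m' := m - q * s.len
      have hqlen : (List.replicate q s.str).flatten.length = q * s.len := by simp
      obtain ⟨k, hk, h⟩ := ih m' (off + q * s.len)
        (if q = 0 then cand else some (s, off + q * s.len - s.len)) hm1 hm2
      refine ⟨k + 1, by simp only [height]; omega, ?_⟩
      rw [htake]
      have hk1 : ∀ f, k + 1 + f = k + f + 1 := fun f => by omega
      simp only [hk1, hstep]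
      rcases h with ⟨j, a, h3, h4⟩ | ⟨h3, h4⟩ | ⟨c, o, h3, h4, h5, h6, h7⟩
      · refine Or.inl ⟨q * s.len + j, a, ?_, fun f => by rw [h4, add_assoc]⟩
        have := h3.append_left (List.replicate q s.str).flatten
        rwa [hqlen] at this
      · by_cases hq : q = 0
        · refine Or.inr (Or.inl ⟨?_, fun f => by rw [h4, if_pos hq]⟩)
          simpa [hq] using h3
        · obtain ⟨p, hp⟩ := Nat.exists_eq_succ_of_ne_zero hq
          have hqp : q * s.len = p * s.len + s.len := by rw [hp, Nat.succ_mul]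
          refine Or.inr (Or.inr ⟨s, off + q * s.len - s.len, by omega, hmin,
            by simp only [height]; omega, fun j a hj => ?_, fun f => by rw [h4, if_neg hq]⟩)
          have h8 := (hj.append_left (List.replicate p s.str).flatten).append_right h3
          rw [hp, Nat.succ_eq_add_one, List.replicate_add, List.flatten_append]
          have h9 : off + (p + 1) * s.len - s.len - off + j =
              (List.replicate p s.str).flatten.length + j := by
            rw [Nat.add_mul]; simp; omega
          rw [h9]
          simpa using h8
      · refine Or.inr (Or.inr ⟨c, o, by omega, h4, by simp only [height]; omega,
          fun j a hj => ?_, h7⟩)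
        have := (h6 j a hj).append_left (List.replicate q s.str).flatten
        rw [hqlen] at this
        rwa [show o - off + j = q * s.len + (o - (off + q * s.len) + j) by omega]
    · have hmin' : ok (pow s n).minSym = false := by simpa using hmin
      refine ⟨1, by omega, Or.inr (Or.inl ⟨fun b hb => ?_, fun f => ?_⟩)⟩
      · exact forall_not_ok_of_minSym hok hmin' b (List.mem_of_mem_take hb)
      · rw [add_comm, search_of_not_ok hmin']

/-- The search in a whole tree that contains a suitable symbol: a failure at a right child is
noticed at once, so every level costs at most two iterations. -/
theorem search_whole {ok : ℕ → Bool} (hok : ∀ a b, a ≤ b → ok b = true → ok a = true)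
    (t : RLTree) (hmin : ok t.minSym = true) (off : ℕ) (cand : Option (RLTree × ℕ)) :
    ∃ k ≤ 2 * t.height + 1, ∃ j a, LastOk ok t.str j a ∧
      ∀ f, search ok (k + f) t t.len off cand = some (off + j, a) := by
  induction t generalizing off cand with
  | leaf a =>
    refine ⟨1, by omega, 1, a, ⟨[], [], by simp [str], rfl, hmin, by simp⟩, fun f => ?_⟩
    rw [add_comm, search.eq_def]
    simp [hmin]
  | pair l r hl hr =>
    have hstep : ∀ f, search ok (f + 1) (pair l r) (pair l r).len off cand =
        search ok f r r.len (off + l.len) (if ok l.minSym then some (l, off) else cand) := by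
      intro f
      have h1 : ¬ (pair l r).len ≤ l.len := by
        have := r.len_pos
        simp only [len]; omega
      rw [search.eq_def]
      simp only [hmin, if_true, h1, if_false]
      rw [len, Nat.add_sub_cancel_left]
    by_cases hrmin : ok r.minSym = true
    · obtain ⟨k, hk, j, a, h1, h2⟩ := hr hrmin (off + l.len)
        (if ok l.minSym then some (l, off) else cand)
      refine ⟨k + 1, by simp only [height]; omega, l.len + j, a, ?_, fun f => ?_⟩
      · simpa [str] using h1.append_left l.str
      · rw [show k + 1 + f = k + f + 1 by omega, hstep, h2, add_assoc]
    · have hrmin' : ok r.minSym = false := by simpa using hrmin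
      have hlmin : ok l.minSym = true := by
        rw [minSym] at hmin
        rcases min_choice l.minSym r.minSym with h | h
        · rwa [h] at hmin
        · rw [h] at hmin; exact absurd hmin hrmin
      obtain ⟨k, hk, j, a, h1, h2⟩ := hl hlmin off none
      refine ⟨k + 2, by simp only [height]; omega, j, a, ?_, fun f => ?_⟩
      · exact h1.append_right (forall_not_ok_of_minSym hok hrmin')
      · rw [show k + 2 + f = k + f + 1 + 1 by omega, hstep, search_of_not_ok hrmin', if_pos hlmin]
        exact h2 f
  | pow s n ih =>
    have hl := s.len_pos
    have hq : ((pow s n).len - 1) / s.len = n := by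
      rw [len, Nat.add_mul, one_mul]
      rw [Nat.div_eq_of_lt_le]
      · omega
      · rw [Nat.succ_mul]; omega
    obtain ⟨k, hk, j, a, h1, h2⟩ := ih hmin (off + n * s.len)
      (if n = 0 then cand else some (s, off + n * s.len - s.len))
    refine ⟨k + 1, by simp only [height]; omega, n * s.len + j, a, ?_, fun f => ?_⟩
    · have := h1.append_left (List.replicate n s.str).flatten
      simpa [str, List.replicate_add] using this
    · rw [show k + 1 + f = k + f + 1 by omega, search.eq_def]
      simp only [hmin, if_true, hq]
      rw [show (pow s n).len - n * s.len = s.len by rw [len, Nat.add_mul]; omega, h2, add_assoc]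

theorem search_correct {ok : ℕ → Bool} (hok : ∀ a b, a ≤ b → ok b = true → ok a = true)
    (t : RLTree) (m : ℕ) (h1 : 1 ≤ m) (h2 : m ≤ t.len) :
    ∃ k ≤ 3 * t.height + 2,
      (∃ j a, LastOk ok (t.str.take m) j a ∧ search ok k t m 0 none = some (j, a)) ∨
      ((∀ b ∈ t.str.take m, ok b = false) ∧ search ok k t m 0 none = some (0, 0)) := by
  obtain ⟨k, hk, ⟨j, a, h3, h4⟩ | ⟨h3, h4⟩ | ⟨c, o, h3, h4, h5, h6, h7⟩⟩ :=
    search_descent hok t m 0 none h1 h2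
  · exact ⟨k, by omega, Or.inl ⟨j, a, h3, by simpa using h4 0⟩⟩
  · exact ⟨k, by omega, Or.inr ⟨h3, by simpa [searchFail] using h4 0⟩⟩
  · obtain ⟨k', hk', j, a, h8, h9⟩ := search_whole hok c h4 o none
    refine ⟨k + k', by omega, Or.inl ⟨o + j, a, by simpa using h6 j a h8, ?_⟩⟩
    rw [h7]
    exact h9 0

end RLTree

/-! ### Running programs -/

/-- From `c`, at most `N` steps lead to a configuration satisfying `Q`. -/
def Reaches (W : ℕ) (P : List Instr) (N : ℕ) (c : Config) (Q : Config → Prop) : Prop :=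
  ∃ k ≤ N, ∃ c', run W P k c = some c' ∧ Q c'

theorem run_add (W : ℕ) (P : List Instr) (j k : ℕ) (c : Config) :
    run W P (j + k) c = (run W P j c).bind (run W P k) := by
  induction j generalizing c with
  | zero => simp [run]
  | succ j ih =>
    rw [show j + 1 + k = j + k + 1 by omega, run, run, Option.bind_assoc]
    congr 1
    funext c'
    exact ih c'

namespace Reaches

variable {W : ℕ} {P : List Instr} {N M : ℕ} {Q Q' : Config → Prop}

theorem refl {c : Config} (h : Q c) : Reaches W P N c Q := ⟨0, Nat.zero_le _, c, rfl, h⟩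

theorem mono {c : Config} (h : Reaches W P M c Q) (hMN : M ≤ N) : Reaches W P N c Q := by
  obtain ⟨k, hk, h⟩ := h
  exact ⟨k, hk.trans hMN, h⟩

theorem trans {c : Config} (h : Reaches W P M c Q') (h' : ∀ c', Q' c' → Reaches W P N c' Q) :
    Reaches W P (M + N) c Q := by
  obtain ⟨j, hj, c', h1, h2⟩ := h
  obtain ⟨k, hk, c'', h3, h4⟩ := h' c' h2
  exact ⟨j + k, Nat.add_le_add hj hk, c'', by rw [run_add, h1]; exact h3, h4⟩

theorem head {c c' : Config} (h : step W P c = some c') (h' : Reaches W P N c' Q) :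
    Reaches W P (N + 1) c Q := by
  obtain ⟨k, hk, c'', h1, h2⟩ := h'
  exact ⟨k + 1, Nat.succ_le_succ hk, c'', by rw [run, h]; exact h1, h2⟩

variable {pc r a b k l v x y : ℕ} {reg : ℕ → ℕ} {mem : List ℕ}

theorem const (h : P[pc]? = some (.const r k)) (hk : k < 2 ^ W)
    (h' : Reaches W P N ⟨pc + 1, Function.update reg r k, mem⟩ Q) :
    Reaches W P (N + 1) ⟨pc, reg, mem⟩ Q :=
  head (by simp [step, h, Config.assign, Nat.mod_eq_of_lt hk]) h'

theorem copy (h : P[pc]? = some (.copy r a)) (ha : reg a = v) (hv : v < 2 ^ W)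
    (h' : Reaches W P N ⟨pc + 1, Function.update reg r v, mem⟩ Q) :
    Reaches W P (N + 1) ⟨pc, reg, mem⟩ Q :=
  head (by simp [step, h, Config.assign, ha, Nat.mod_eq_of_lt hv]) h'

theorem add (h : P[pc]? = some (.add r a b)) (ha : reg a = x) (hb : reg b = y)
    (hv : x + y < 2 ^ W) (h' : Reaches W P N ⟨pc + 1, Function.update reg r (x + y), mem⟩ Q) :
    Reaches W P (N + 1) ⟨pc, reg, mem⟩ Q :=
  head (by simp [step, h, Config.assign, ha, hb, Nat.mod_eq_of_lt hv]) h'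

theorem sub (h : P[pc]? = some (.sub r a b)) (ha : reg a = x) (hb : reg b = y)
    (hv : x < 2 ^ W) (h' : Reaches W P N ⟨pc + 1, Function.update reg r (x - y), mem⟩ Q) :
    Reaches W P (N + 1) ⟨pc, reg, mem⟩ Q :=
  head (by simp [step, h, Config.assign, ha, hb,
    Nat.mod_eq_of_lt ((Nat.sub_le x y).trans_lt hv)]) h'

theorem mul (h : P[pc]? = some (.mul r a b)) (ha : reg a = x) (hb : reg b = y)
    (hv : x * y < 2 ^ W) (h' : Reaches W P N ⟨pc + 1, Function.update reg r (x * y), mem⟩ Q) :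
    Reaches W P (N + 1) ⟨pc, reg, mem⟩ Q :=
  head (by simp [step, h, Config.assign, ha, hb, Nat.mod_eq_of_lt hv]) h'

theorem div (h : P[pc]? = some (.div r a b)) (ha : reg a = x) (hb : reg b = y)
    (hv : x < 2 ^ W) (h' : Reaches W P N ⟨pc + 1, Function.update reg r (x / y), mem⟩ Q) :
    Reaches W P (N + 1) ⟨pc, reg, mem⟩ Q :=
  head (by simp [step, h, Config.assign, ha, hb,
    Nat.mod_eq_of_lt ((Nat.div_le_self x y).trans_lt hv)]) h'

theorem load (h : P[pc]? = some (.load r a)) (ha : reg a = x) (hx : mem[x]? = some v)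
    (hmem : ∀ z ∈ mem, z < 2 ^ W)
    (h' : Reaches W P N ⟨pc + 1, Function.update reg r v, mem⟩ Q) :
    Reaches W P (N + 1) ⟨pc, reg, mem⟩ Q :=
  head (by simp [step, h, Config.assign, ha, hx,
    Nat.mod_eq_of_lt (hmem v (List.mem_of_getElem? hx))]) h'

theorem jump (h : P[pc]? = some (.jump l)) (h' : Reaches W P N ⟨l, reg, mem⟩ Q) :
    Reaches W P (N + 1) ⟨pc, reg, mem⟩ Q :=
  head (by simp [step, h]) h'

theorem jumpLt_true (h : P[pc]? = some (.jumpLt a b l)) (ha : reg a = x) (hb : reg b = y)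
    (hxy : x < y) (h' : Reaches W P N ⟨l, reg, mem⟩ Q) :
    Reaches W P (N + 1) ⟨pc, reg, mem⟩ Q :=
  head (by simp [step, h, ha, hb, hxy]) h'

theorem jumpLt_false (h : P[pc]? = some (.jumpLt a b l)) (ha : reg a = x) (hb : reg b = y)
    (hxy : ¬ x < y) (h' : Reaches W P N ⟨pc + 1, reg, mem⟩ Q) :
    Reaches W P (N + 1) ⟨pc, reg, mem⟩ Q :=
  head (by simp [step, h, ha, hb, hxy]) h'

end Reaches

/-- The code `code` occupies the program `P` from address `base` on. -/
def CodeAt (P : List Instr) (base : ℕ) (code : List Instr) : Prop :=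
  ∀ i ins, code[i]? = some ins → P[base + i]? = some ins

theorem codeAt_self (P : List Instr) : CodeAt P 0 P := fun i ins h => by rwa [Nat.zero_add]

theorem CodeAt.left {P a b : List Instr} {base : ℕ} (h : CodeAt P base (a ++ b)) :
    CodeAt P base a := fun i ins hi => h i ins (by
  rw [List.getElem?_append_left (List.getElem?_eq_some_iff.1 hi).1]; exact hi)

theorem CodeAt.right {P a b : List Instr} {base : ℕ} (h : CodeAt P base (a ++ b)) :
    CodeAt P (base + a.length) b := fun i ins hi => by
  rw [add_assoc]
  exact h _ _ (by rw [List.getElem?_append_right (by omega), Nat.add_sub_cancel_left]; exact hi)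

/-! ### The stored tree -/

/-- The memory stores the distinct subtrees of `root` as records of five words: smallest symbol,
two children, length, and kind (`0` for a leaf, `1` for a pair, `2` for a power). The left and the
right child are found at offsets `oL` and `oR`; exchanging the two offsets mirrors the tree. No
record has address `0`, which stands for a missing tree. -/
structure Stored (mem : List ℕ) (W oL oR : ℕ) (root : RLTree) (addr : RLTree → ℕ) : Prop where
  word_lt : ∀ x ∈ mem, x < 2 ^ W
  length_le : mem.length ≤ 2 ^ W
  addr_pos : ∀ s, 0 < addr s
  minSym : ∀ s ∈ root.subterms, mem[addr s]? = some s.minSym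
  len : ∀ s ∈ root.subterms, mem[addr s + 3]? = some s.len
  leaf : ∀ a, .leaf a ∈ root.subterms → mem[addr (.leaf a) + 4]? = some 0
  pair : ∀ l r, .pair l r ∈ root.subterms → mem[addr (.pair l r) + 4]? = some 1 ∧
    mem[addr (.pair l r) + oL]? = some (addr l) ∧ mem[addr (.pair l r) + oR]? = some (addr r)
  pow : ∀ s k, .pow s k ∈ root.subterms → mem[addr (.pow s k) + 4]? = some 2 ∧
    mem[addr (.pow s k) + oL]? = some (addr s) ∧ mem[addr (.pow s k) + oR]? = some (addr s)

theorem Stored.mirror {mem : List ℕ} {W oL oR : ℕ} {root : RLTree} {addr : RLTree → ℕ}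
    (h : Stored mem W oL oR root addr) :
    Stored mem W oR oL root.mirror fun s => addr s.mirror := by
  have hmem : ∀ {s}, s ∈ root.mirror.subterms → s.mirror ∈ root.subterms := by
    intro s hs
    rw [RLTree.subterms_mirror, Finset.mem_image] at hs
    obtain ⟨t, ht, rfl⟩ := hs
    simpa using ht
  refine ⟨h.word_lt, h.length_le, fun s => h.addr_pos _, fun s hs => ?_, fun s hs => ?_,
    fun a hs => h.leaf a (hmem hs), fun l r hs => ?_, fun s k hs => ?_⟩
  · simpa using h.minSym _ (hmem hs)
  · simpa using h.len _ (hmem hs)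
  · have := h.pair _ _ (hmem hs)
    exact ⟨this.1, this.2.2, this.2.1⟩
  · have := h.pow _ _ (hmem hs)
    exact ⟨this.1, this.2.2, this.2.1⟩

theorem Stored.lt_of_getElem? {mem : List ℕ} {W oL oR : ℕ} {root : RLTree} {addr : RLTree → ℕ}
    (h : Stored mem W oL oR root addr) {i v : ℕ} (hi : mem[i]? = some v) : i < 2 ^ W :=
  (List.getElem?_eq_some_iff.1 hi).1.trans_le h.length_le

/-! ### The search program -/

/-- Jump to `l` if the symbol in register `r` is suitable: any symbol if `any` is set, and
otherwise a symbol below the one in register `1`. -/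
def testInstr (any : Bool) (r l : ℕ) : Instr :=
  if any then .jump l else .jumpLt r 1 l

/-- The condition that `testInstr` tests, where register `1` holds `d`. -/
def okSym (any : Bool) (d x : ℕ) : Bool := any || decide (x < d)

theorem Reaches.test {W : ℕ} {P : List Instr} {N : ℕ} {Q : Config → Prop} {any : Bool}
    {pc r l d x : ℕ} {reg : ℕ → ℕ} {mem : List ℕ} (h : P[pc]? = some (testInstr any r l))
    (hr : reg r = x) (hd : reg 1 = d)
    (h' : Reaches W P N ⟨if okSym any d x then l else pc + 1, reg, mem⟩ Q) :
    Reaches W P (N + 1) ⟨pc, reg, mem⟩ Q := by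
  cases any
  · refine head (c' := ⟨if okSym false d x then l else pc + 1, reg, mem⟩) ?_ h'
    simp [step, h, testInstr, okSym, hr, hd]
  · refine head (c' := ⟨if okSym true d x then l else pc + 1, reg, mem⟩) ?_ h'
    simp [step, h, testInstr, okSym]

/-- `RLTree.search` as a program at address `base` that continues at address `e`. Registers `3`,
`4`, `5` hold the current tree, the target position inside it and its offset; `6` and `7` hold the
candidate and its offset. Registers `14`, …, `17` and `20` hold the constants `1`, …, `4` and `0`,
and `18` and `19` hold the offsets of the children. The result is left in register `0`, and the
symbol found in register `8`. -/
def searchCode (any : Bool) (base e : ℕ) : List Instr :=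
  [ .load 8 3, testInstr any 8 (base + 11), .jumpLt 20 6 (base + 5), .const 0 0, .jump e,
    .copy 3 6, .copy 5 7, .copy 6 20, .add 9 3 16, .load 4 9, .jump base,
    .add 9 3 17, .load 9 9, .jumpLt 9 14 (base + 42),
    .add 10 3 18, .load 10 10, .add 11 10 16, .load 11 11, .jumpLt 9 15 (base + 29),
    .copy 3 10, .sub 12 4 14, .div 12 12 11, .jumpLt 12 14 base, .mul 13 12 11, .sub 4 4 13,
    .add 5 5 13, .copy 6 10, .sub 7 5 11, .jump base,
    .jumpLt 11 4 (base + 32), .copy 3 10, .jump base,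
    .load 12 10, .sub 4 4 11, testInstr any 12 (base + 36), .jump (base + 38),
    .copy 6 10, .copy 7 5, .add 5 5 11, .add 9 3 19, .load 3 9, .jump base,
    .add 0 5 14, .jump e ]

/-- The registers that the search leaves unchanged: `d` and `i` are the arguments of the query,
and `z` is arbitrary. -/
def Env (d i z oL oR : ℕ) (reg : ℕ → ℕ) : Prop :=
  reg 1 = d ∧ reg 2 = i ∧ reg 14 = 1 ∧ reg 15 = 2 ∧ reg 16 = 3 ∧ reg 17 = 4 ∧ reg 18 = oL ∧
    reg 19 = oR ∧ reg 20 = 0 ∧ reg 21 = z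

theorem Env.update {d i z oL oR : ℕ} {reg : ℕ → ℕ} (h : Env d i z oL oR reg) {r : ℕ}
    (hr : r < 14 ∧ r ≠ 1 ∧ r ≠ 2) (v : ℕ) : Env d i z oL oR (Function.update reg r v) := by
  obtain ⟨h1, h2, h3⟩ := hr
  unfold Env at h ⊢
  simp only [Function.update_apply]
  rw [if_neg (by omega), if_neg (by omega), if_neg (by omega), if_neg (by omega),
    if_neg (by omega), if_neg (by omega), if_neg (by omega), if_neg (by omega),
    if_neg (by omega), if_neg (by omega)]
  exact h

open RLTree in
/-- The program simulates the search, with at most `20` steps per iteration. -/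
theorem reaches_searchCode {W : ℕ} {P : List Instr} {mem : List ℕ} {oL oR : ℕ} {root : RLTree}
    {addr : RLTree → ℕ} {any : Bool} {base e d i z : ℕ}
    (hC : CodeAt P base (searchCode any base e)) (hS : Stored mem W oL oR root addr) (k : ℕ) :
    ∀ (t : RLTree) (m off : ℕ) (cand : Option (RLTree × ℕ)) (r : ℕ × ℕ) (reg : ℕ → ℕ),
      search (okSym any d) k t m off cand = some r → t ∈ root.subterms → 1 ≤ m → m ≤ t.len →
      off + t.len ≤ root.len → Env d i z oL oR reg → reg 3 = addr t → reg 4 = m → reg 5 = off →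
      (cand = none → reg 6 = 0) →
      (∀ c o, cand = some (c, o) → c ∈ root.subterms ∧ o + c.len ≤ root.len ∧
        reg 6 = addr c ∧ reg 7 = o) →
      Reaches W P (20 * k) ⟨base, reg, mem⟩ fun c => c.pc = e ∧ c.mem = mem ∧ c.reg 0 = r.1 ∧
        (r.1 ≠ 0 → c.reg 8 = r.2) ∧ Env d i z oL oR c.reg := by
  have hrl := hS.len root root.self_mem_subterms
  have hroot : root.len < 2 ^ W := hS.word_lt _ (List.mem_of_getElem? hrl)
  have h1W : 1 < 2 ^ W := by
    have h1 := hS.addr_pos root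
    have h2 := hS.lt_of_getElem? hrl
    omega
  induction k with
  | zero => intro t m off cand r reg h; simp [search] at h
  | succ k ih =>
    intro t m off cand r reg hr ht hm1 hm2 hoff hE h3 h4 h5 hnone hsome
    obtain ⟨e1, -, e14, e15, e16, e17, e18, -, e20, -⟩ := id hE
    have hlenW : ∀ s ∈ root.subterms, addr s + 3 < 2 ^ W := fun s hs =>
      hS.lt_of_getElem? (hS.len s hs)
    have haddrW : ∀ s ∈ root.subterms, addr s < 2 ^ W := fun s hs =>
      lt_of_le_of_lt (Nat.le_add_right _ 3) (hlenW s hs)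
    by_cases hok : okSym any d t.minSym = true
    · -- The header shared by the three kinds of nodes, up to loading the kind `κ`.
      have hkind : ∀ κ N (Q : Config → Prop), mem[addr t + 4]? = some κ →
          Reaches W P N ⟨base + 13, Function.update (Function.update (Function.update reg 8
            t.minSym) 9 (addr t + 4)) 9 κ, mem⟩ Q →
          Reaches W P (N + 4) ⟨base, reg, mem⟩ Q := by
        intro κ N Q hκ h
        refine Reaches.load (hC 0 _ rfl) h3 (hS.minSym t ht) hS.word_lt ?_
        refine Reaches.test (x := t.minSym) (d := d) (hC 1 _ rfl) (by simp)
          (by simp [e1]) ?_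
        rw [if_pos hok]
        refine Reaches.add (x := addr t) (y := 4) (hC 11 _ rfl)
          (by simp [h3]) (by simp [e17])
          (hS.lt_of_getElem? hκ) ?_
        exact Reaches.load (x := addr t + 4) (hC 12 _ rfl) (by simp) hκ hS.word_lt h
      -- Loading the left child `s` and its length, and the test for powers.
      have hchild : ∀ κ s N (Q : Config → Prop), 1 ≤ κ → mem[addr t + 4]? = some κ →
          mem[addr t + oL]? = some (addr s) → s ∈ root.subterms →
          (∀ reg', Env d i z oL oR reg' → reg' 3 = addr t → reg' 4 = m → reg' 5 = off →
            reg' 6 = reg 6 → reg' 7 = reg 7 → reg' 10 = addr s → reg' 11 = s.len →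
            Reaches W P N ⟨if κ < 2 then base + 29 else base + 19, reg', mem⟩ Q) →
          Reaches W P (N + 10) ⟨base, reg, mem⟩ Q := by
        intro κ s N Q hκ1 hκ hs hsr h
        refine hkind κ (N + 6) Q hκ ?_
        refine Reaches.jumpLt_false (x := κ) (y := 1) (hC 13 _ rfl) (by simp)
          (by simp [e14]) (by omega) ?_
        refine Reaches.add (x := addr t) (y := oL) (hC 14 _ rfl)
          (by simp [h3]) (by simp [e18])
          (hS.lt_of_getElem? hs) ?_
        refine Reaches.load (x := addr t + oL) (hC 15 _ rfl) (by simp) hs hS.word_lt ?_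
        refine Reaches.add (x := addr s) (y := 3) (hC 16 _ rfl)
          (by simp) (by simp [e16]) (hlenW s hsr) ?_
        refine Reaches.load (x := addr s + 3) (hC 17 _ rfl) (by simp) (hS.len s hsr)
          hS.word_lt ?_
        have hfin := h (Function.update (Function.update (Function.update (Function.update
          (Function.update (Function.update (Function.update reg 8 t.minSym) 9 (addr t + 4)) 9 κ)
            10 (addr t + oL)) 10 (addr s)) 11 (addr s + 3)) 11 s.len)
          (((((((hE.update (by decide) _).update (by decide) _).update (by decide) _).update
            (by decide) _).update (by decide) _).update (by decide) _).update (by decide) _)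
          (by simp [h3]) (by simp [h4])
          (by simp [h5]) (by simp)
          (by simp) (by simp) (by simp)
        by_cases hκ2 : κ < 2
        · rw [if_pos hκ2] at hfin
          exact Reaches.jumpLt_true (x := κ) (y := 2) (hC 18 _ rfl)
            (by simp) (by simp [e15]) hκ2 hfin
        · rw [if_neg hκ2] at hfin
          exact Reaches.jumpLt_false (x := κ) (y := 2) (hC 18 _ rfl)
            (by simp) (by simp [e15]) hκ2 hfin
      cases t with
      | leaf a =>
        have hr' : (off + 1, a) = r := by
          rw [search.eq_def] at hr
          simpa [hok] using hr
        subst hr'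
        refine Reaches.mono (M := 0 + 3 + 4) ?_ (by omega)
        refine hkind 0 _ _ (hS.leaf a ht) ?_
        refine Reaches.jumpLt_true (x := 0) (y := 1) (hC 13 _ rfl) (by simp)
          (by simp [e14]) (by omega) ?_
        simp only [len] at hoff
        refine Reaches.add (x := off) (y := 1) (hC 42 _ rfl)
          (by simp [h5]) (by simp [e14])
          (by omega) ?_
        refine Reaches.jump (hC 43 _ rfl) (Reaches.refl ⟨rfl, rfl, by simp, fun _ => ?_, ?_⟩)
        · simp [minSym]
        · exact (((hE.update (by decide) _).update (by decide) _).update (by decide) _).update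
            (by decide) _
      | pair l s =>
        obtain ⟨hk4, hkL, hkR⟩ := hS.pair l s ht
        have hlr := subterms_trans ht (mem_subterms_left l s)
        have hsr := subterms_trans ht (mem_subterms_right l s)
        simp only [len] at hm2 hoff
        refine Reaches.mono (M := (20 * k + 10) + 10) ?_ (by omega)
        refine hchild 1 l _ _ le_rfl hk4 hkL hlr ?_
        intro reg' hE' g3 g4 g5 g6 g7 g10 g11
        have f1 := hE'.1
        rw [if_pos (by norm_num)]
        rw [search.eq_def] at hr
        simp only [hok, if_true] at hr
        by_cases hm : m ≤ l.len
        · rw [if_pos hm] at hr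
          refine Reaches.mono (M := 20 * k + 3) ?_ (by omega)
          refine Reaches.jumpLt_false (hC 29 _ rfl) g11 g4 (by omega) ?_
          refine Reaches.copy (hC 30 _ rfl) g10 (haddrW l hlr) ?_
          refine Reaches.jump (hC 31 _ rfl) ?_
          refine ih l m off cand r _ hr hlr hm1 hm (by omega) (hE'.update (by decide) _)
            (by simp) (by simp [g4])
            (by simp [g5])
            (fun h => by simp [g6, hnone h]) (fun c o h => ?_)
          simpa [g6, g7] using hsome c o h
        · rw [if_neg hm] at hr
          refine Reaches.jumpLt_true (hC 29 _ rfl) g11 g4 (by omega) ?_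
          refine Reaches.load (hC 32 _ rfl) g10 (hS.minSym l hlr) hS.word_lt ?_
          refine Reaches.sub (x := m) (y := l.len) (hC 33 _ rfl)
            (by simp [g4]) (by simp [g11])
            (by omega) ?_
          refine Reaches.test (x := l.minSym) (d := d) (hC 34 _ rfl)
            (by simp) (by simp [f1]) ?_
          -- The last four instructions, for any contents of the candidate registers.
          have htail : ∀ reg'', Env d i z oL oR reg'' → reg'' 3 = addr (pair l s) →
              reg'' 4 = m - l.len → reg'' 5 = off → reg'' 11 = l.len →
              ((if okSym any d l.minSym then some (l, off) else cand) = none → reg'' 6 = 0) →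
              (∀ c o, (if okSym any d l.minSym then some (l, off) else cand) = some (c, o) →
                c ∈ root.subterms ∧ o + c.len ≤ root.len ∧ reg'' 6 = addr c ∧ reg'' 7 = o) →
              Reaches W P (20 * k + 4) ⟨base + 38, reg'', mem⟩ fun c => c.pc = e ∧ c.mem = mem ∧
                c.reg 0 = r.1 ∧ (r.1 ≠ 0 → c.reg 8 = r.2) ∧ Env d i z oL oR c.reg := by
            intro reg'' hE'' k3 k4 k5 k11 kn ks
            obtain ⟨-, -, -, -, -, -, -, p19, -, -⟩ := id hE''
            refine Reaches.add (hC 38 _ rfl) k5 k11 (by omega) ?_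
            refine Reaches.add (x := addr (pair l s)) (y := oR) (hC 39 _ rfl)
              (by simp [k3]) (by simp [p19])
              (hS.lt_of_getElem? hkR) ?_
            refine Reaches.load (x := addr (pair l s) + oR) (hC 40 _ rfl) (by simp) hkR
              hS.word_lt ?_
            refine Reaches.jump (hC 41 _ rfl) ?_
            refine ih s (m - l.len) (off + l.len) _ r _ hr hsr (by omega) (by omega) (by omega)
              (((hE''.update (by decide) _).update (by decide) _).update (by decide) _)
              (by simp) (by simp [k4]) (by simp)
              (fun h => by simp [kn h]) (fun c o h => ?_)
            simpa using ks c o h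
          by_cases hl : okSym any d l.minSym = true
          · rw [if_pos hl]
            refine Reaches.copy (v := addr l) (hC 36 _ rfl) (by simp [g10])
              (haddrW l hlr) ?_
            refine Reaches.copy (v := off) (hC 37 _ rfl) (by simp [g5])
              (by omega) ?_
            refine htail _
              ((((hE'.update (by decide) _).update (by decide) _).update (by decide) _).update
                (by decide) _) (by simp [g3])
              (by simp) (by simp [g5])
              (by simp [g11]) (fun h => by simp [hl] at h)
              (fun c o h => ?_)
            rw [if_pos hl] at h
            obtain ⟨rfl, rfl⟩ : l = c ∧ off = o := by simpa using h
            exact ⟨hlr, by omega, by simp, by simp⟩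
          · rw [if_neg hl]
            refine Reaches.mono (M := 20 * k + 5) ?_ (by omega)
            refine Reaches.jump (hC 35 _ rfl) ?_
            refine htail _ ((hE'.update (by decide) _).update (by decide) _)
              (by simp [g3])
              (by simp) (by simp [g5])
              (by simp [g11])
              (fun h => ?_) (fun c o h => ?_)
            · rw [if_neg hl] at h
              simp [g6, hnone h]
            · rw [if_neg hl] at h
              simpa [g6, g7] using hsome c o h
      | pow s n =>
        obtain ⟨hk4, hkL, -⟩ := hS.pow s n ht
        have hsr := subterms_trans ht (mem_subterms_pow s n)
        obtain ⟨-, hq1, hq2, hq3⟩ := take_pow_str hm1 hm2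
        have hqm : (m - 1) / s.len * s.len ≤ m - 1 := Nat.div_mul_le_self _ _
        refine Reaches.mono (M := (20 * k + 10) + 10) ?_ (by omega)
        refine hchild 2 s _ _ (by norm_num) hk4 hkL hsr ?_
        intro reg' hE' g3 g4 g5 g6 g7 g10 g11
        have f14 := hE'.2.2.1
        rw [if_neg (by norm_num)]
        rw [search.eq_def] at hr
        simp only [hok, if_true] at hr
        have hqs : (m - 1) / s.len * s.len + s.len ≤ (pow s n).len := by
          rw [len, Nat.add_mul, one_mul]
          exact Nat.add_le_add_right (Nat.mul_le_mul_right _ hq3) _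
        have hsl := s.len_pos
        set q := (m - 1) / s.len with hq
        refine Reaches.copy (hC 19 _ rfl) g10 (haddrW s hsr) ?_
        refine Reaches.sub (x := m) (y := 1) (hC 20 _ rfl)
          (by simp [g4]) (by simp [f14])
          (by omega) ?_
        refine Reaches.div (x := m - 1) (y := s.len) (hC 21 _ rfl)
          (by simp) (by simp [g11]) (by omega) ?_
        by_cases hq0 : q = 0
        · refine Reaches.mono (M := 20 * k + 1) ?_ (by omega)
          refine Reaches.jumpLt_true (x := q) (y := 1) (hC 22 _ rfl) (by simp [hq])
            (by simp [f14]) (by omega) ?_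
          rw [hq0, if_pos rfl, Nat.zero_mul] at hr
          rw [hq0, Nat.zero_mul] at hqs hq2
          refine ih s (m - 0) (off + 0) cand r _ hr hsr hm1 hq2 (by omega)
            (((hE'.update (by decide) _).update (by decide) _).update (by decide) _)
            (by simp) (by simp [g4])
            (by simp [g5])
            (fun h => by simp [g6, hnone h]) (fun c o h => ?_)
          simpa [g6, g7] using hsome c o h
        · refine Reaches.jumpLt_false (x := q) (y := 1) (hC 22 _ rfl) (by simp [hq])
            (by simp [f14]) (not_lt.2 (Nat.pos_of_ne_zero hq0)) ?_
          refine Reaches.mul (x := q) (y := s.len) (hC 23 _ rfl) (by simp [hq])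
            (by simp [g11]) (by omega) ?_
          refine Reaches.sub (x := m) (y := q * s.len) (hC 24 _ rfl)
            (by simp [g4]) (by simp) (by omega) ?_
          refine Reaches.add (x := off) (y := q * s.len) (hC 25 _ rfl)
            (by simp [g5]) (by simp) (by omega) ?_
          refine Reaches.copy (v := addr s) (hC 26 _ rfl) (by simp [g10])
            (haddrW s hsr) ?_
          refine Reaches.sub (x := off + q * s.len) (y := s.len) (hC 27 _ rfl)
            (by simp) (by simp [g11]) (by omega) ?_
          refine Reaches.mono (M := 20 * k + 1) ?_ (by omega)
          refine Reaches.jump (hC 28 _ rfl) ?_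
          rw [if_neg hq0] at hr
          refine ih s (m - q * s.len) (off + q * s.len) _ r _ hr hsr hq1 hq2 (by omega)
            ((((((((hE'.update (by decide) _).update (by decide) _).update (by decide) _).update
              (by decide) _).update (by decide) _).update (by decide) _).update
              (by decide) _).update (by decide) _)
            (by simp) (by simp)
            (by simp) (fun h => by simp at h) (fun c o h => ?_)
          obtain ⟨rfl, rfl⟩ : s = c ∧ off + q * s.len - s.len = o := by simpa using h
          have : s.len ≤ q * s.len := Nat.le_mul_of_pos_left _ (Nat.pos_of_ne_zero hq0)
          exact ⟨hsr, by omega, by simp, by simp⟩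
    · have hok' : okSym any d t.minSym = false := by simpa using hok
      rw [search_of_not_ok hok'] at hr
      refine Reaches.mono (M := 20 * k + 9) ?_ (by omega)
      refine Reaches.load (hC 0 _ rfl) h3 (hS.minSym t ht) hS.word_lt ?_
      refine Reaches.test (x := t.minSym) (d := d) (hC 1 _ rfl) (by simp)
        (by simp [e1]) ?_
      rw [if_neg hok]
      cases cand with
      | none =>
        have hr' : (0, 0) = r := by simpa [searchFail] using hr
        subst hr'
        refine Reaches.jumpLt_false (x := 0) (y := 0) (hC 2 _ rfl)
          (by simp [e20]) (by simp [hnone])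
          (by omega) ?_
        refine Reaches.const (hC 3 _ rfl) (by omega) ?_
        refine Reaches.jump (hC 4 _ rfl) (Reaches.refl ⟨rfl, rfl, by simp, fun h => ?_, ?_⟩)
        · exact absurd rfl h
        · exact (hE.update (by decide) _).update (by decide) _
      | some co =>
        obtain ⟨c, o⟩ := co
        obtain ⟨hcr, hco, h6, h7⟩ := hsome c o rfl
        have hcl := c.len_pos
        refine Reaches.jumpLt_true (x := 0) (y := addr c) (hC 2 _ rfl)
          (by simp [e20]) (by simp [h6])
          (hS.addr_pos c) ?_
        refine Reaches.copy (v := addr c) (hC 5 _ rfl) (by simp [h6])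
          (haddrW c hcr) ?_
        refine Reaches.copy (v := o) (hC 6 _ rfl) (by simp [h7])
          (by omega) ?_
        refine Reaches.copy (v := 0) (hC 7 _ rfl) (by simp [e20])
          (by omega) ?_
        refine Reaches.add (x := addr c) (y := 3) (hC 8 _ rfl)
          (by simp) (by simp [e16])
          (hlenW c hcr) ?_
        refine Reaches.load (x := addr c + 3) (hC 9 _ rfl) (by simp) (hS.len c hcr)
          hS.word_lt ?_
        refine Reaches.jump (hC 10 _ rfl) ?_
        exact ih c c.len o none r _ hr hcr hcl le_rfl hco
          ((((((hE.update (by decide) _).update (by decide) _).update (by decide) _).update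
            (by decide) _).update (by decide) _).update (by decide) _)
          (by simp) (by simp) (by simp)
          (fun _ => by simp) (fun c o h => by simp at h)

/-! ### The query programs -/

/-- Save the position argument in register `2` and set up the constants. -/
def initCode : List Instr :=
  [.copy 2 0, .const 14 1, .const 15 2, .const 16 3, .const 17 4]

/-- Load the symbol at the position in register `2` into register `1`: a search in which every
symbol is suitable ends at the target position itself. -/
def accessCode (base : ℕ) : List Instr :=
  [.const 18 1, .const 19 2, .load 3 20, .copy 4 2] ++
    (searchCode true (base + 4) (base + 48) ++ [.copy 1 8])

/-- Find the last symbol below the one in register `1` before the position in register `2`, or, if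
`rev` is set, the first one after that position. The latter is the same search in the mirrored
tree. -/
def mainCode (rev : Bool) (base : ℕ) : List Instr :=
  [.const 18 (if rev then 2 else 1), .const 19 (if rev then 1 else 2), .copy 5 20, .copy 6 20,
    .load 3 20, .add 9 3 16, .load 21 9, if rev then .sub 4 21 2 else .sub 4 2 14,
    .jumpLt 20 4 (base + 11), .const 0 0, .jump (base + 55)] ++
    (searchCode false (base + 11) (base + 55) ++
      (if rev then [.add 21 21 14, .sub 0 21 0, .halt] else [.halt]))

/-- The program for `psvBelow`, or for `nsvBelow` if `rev` is set. -/
def belowProg (rev : Bool) : List Instr := initCode ++ mainCode rev 5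

/-- The program for `psv`, or for `nsv` if `rev` is set. -/
def symbolProg (rev : Bool) : List Instr := initCode ++ (accessCode 5 ++ mainCode rev 54)

/-- The position `r` is the last one in `s` with a suitable symbol, or `0` if there is none. -/
def IsLastOk (ok : ℕ → Bool) (s : List ℕ) (r : ℕ) : Prop :=
  (r = 0 ∨ 1 ≤ r ∧ ∃ a, s[r - 1]? = some a ∧ ok a = true) ∧
    ∀ j, r < j → ∀ b, s[j - 1]? = some b → ok b = false

theorem LastOk.isLastOk {ok : ℕ → Bool} {s : List ℕ} {j a : ℕ} (h : LastOk ok s j a) :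
    IsLastOk ok s j := by
  obtain ⟨x, y, rfl, rfl, h1, h2⟩ := h
  refine ⟨Or.inr ⟨by omega, a, by simp, h1⟩, fun k hk b hb => ?_⟩
  rw [List.getElem?_append_right (by omega), List.getElem?_cons,
    if_neg (by omega)] at hb
  exact h2 b (List.mem_of_getElem? hb)

theorem isLastOk_zero {ok : ℕ → Bool} {s : List ℕ} (h : ∀ b ∈ s, ok b = false) :
    IsLastOk ok s 0 :=
  ⟨Or.inl rfl, fun _ _ b hb => h b (List.mem_of_getElem? hb)⟩

theorem okSym_mono (any : Bool) (d : ℕ) :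
    ∀ a b, a ≤ b → okSym any d b = true → okSym any d a = true := by
  intro a b hab
  simp only [okSym, Bool.or_eq_true, decide_eq_true_eq]
  exact Or.imp_right fun h => by omega

section

variable {W : ℕ} {P : List Instr} {mem : List ℕ} {root : RLTree} {addr : RLTree → ℕ}

/-- The tree in which the program searches, as it is stored for that program. -/
theorem Stored.oriented (hS : Stored mem W 1 2 root addr) (rev : Bool) :
    ∃ addr' : RLTree → ℕ, addr' (if rev then root.mirror else root) = addr root ∧
      Stored mem W (if rev then 2 else 1) (if rev then 1 else 2)
        (if rev then root.mirror else root) addr' := by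
  cases rev
  · exact ⟨addr, rfl, hS⟩
  · exact ⟨_, by simp, hS.mirror⟩

theorem reaches_mainCode {rev : Bool} {base d i : ℕ} {reg : ℕ → ℕ}
    (hC : CodeAt P base (mainCode rev base)) (hS : Stored mem W 1 2 root addr)
    (h0 : mem[0]? = some (addr root)) (hn : root.len + 1 < 2 ^ W) (hi : i ≤ root.len + 1)
    (hE : Env d i (reg 21) (reg 18) (reg 19) reg) :
    Reaches W P (60 * root.height + 55) ⟨base, reg, mem⟩ fun c => P[c.pc]? = some .halt ∧
      c.mem = mem ∧ ∃ r, IsLastOk (okSym false d) (if rev then root.str.reverse.take (root.len - i)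
        else root.str.take (i - 1)) r ∧ c.reg 0 = if rev then root.len + 1 - r else r := by
  obtain ⟨addr', haddr, hS'⟩ := hS.oriented rev
  have hC1 := hC.left
  have hC2 := hC.right.left
  have hC3 := hC.right.right
  simp only [List.length_cons, List.length_nil, zero_add, Nat.reduceAdd] at hC2 hC3
  replace hC3 : CodeAt P (base + 55)
    (if rev then [.add 21 21 14, .sub 0 21 0, .halt] else [.halt]) := hC3
  obtain ⟨e1, e2, e14, e15, e16, e17, -, -, e20, -⟩ := id hE
  have hlen := hS.len root root.self_mem_subterms
  have hlenW := hS.lt_of_getElem? hlen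
  have hpos := hS.addr_pos root
  have h4W : 4 ≤ 2 ^ W := by omega
  have hm0 := root.len_pos
  set T := if rev then root.mirror else root with hT
  set m := if rev then root.len - i else i - 1 with hm
  have hTlen : T.len = root.len := by cases rev <;> simp [hT]
  have hTh : T.height = root.height := by cases rev <;> simp [hT]
  have hTs : (if rev then root.str.reverse.take (root.len - i) else root.str.take (i - 1)) =
      T.str.take m := by
    cases rev <;> simp [hT, hm, RLTree.str_mirror]
  have hmn : m ≤ T.len := by
    rw [hTlen, hm]; split <;> omega
  rw [hTs]
  -- The code after the search.
  have hend : ∀ r (reg' : ℕ → ℕ), reg' 0 = r → reg' 14 = 1 → reg' 21 = root.len →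
      Reaches W P 2 ⟨base + 55, reg', mem⟩ fun c => P[c.pc]? = some .halt ∧ c.mem = mem ∧
        c.reg 0 = if rev then root.len + 1 - r else r := by
    intro r reg' g0 g14 g21
    cases rev
    · exact Reaches.refl ⟨hC3 0 _ rfl, rfl, g0⟩
    · refine Reaches.add (hC3 0 _ rfl) g21 g14 hn ?_
      refine Reaches.sub (x := root.len + 1) (y := r) (hC3 1 _ rfl) (by simp) (by simp [g0]) hn ?_
      exact Reaches.refl ⟨hC3 2 _ rfl, rfl, by simp⟩
  refine Reaches.mono (M := (20 * (3 * T.height + 2) + 2) + 11) ?_ (by omega)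
  refine Reaches.const (hC1 0 _ rfl) (by split <;> omega) ?_
  refine Reaches.const (hC1 1 _ rfl) (by split <;> omega) ?_
  refine Reaches.copy (v := 0) (hC1 2 _ rfl) (by simp [e20]) (by omega) ?_
  refine Reaches.copy (v := 0) (hC1 3 _ rfl) (by simp [e20]) (by omega) ?_
  refine Reaches.load (x := 0) (hC1 4 _ rfl) (by simp [e20]) h0 hS.word_lt ?_
  refine Reaches.add (x := addr root) (y := 3) (hC1 5 _ rfl) (by simp) (by simp [e16]) hlenW ?_
  refine Reaches.load (x := addr root + 3) (hC1 6 _ rfl) (by simp) hlen hS.word_lt ?_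
  have hsub : ∀ N (reg' : ℕ → ℕ) (Q : Config → Prop), reg' 21 = root.len → reg' 2 = i →
      reg' 14 = 1 → Reaches W P N ⟨base + 8, Function.update reg' 4 m, mem⟩ Q →
      Reaches W P (N + 1) ⟨base + 7, reg', mem⟩ Q := by
    intro N reg' Q g21 g2 g14 h
    cases rev
    · exact Reaches.sub (hC1 7 _ rfl) g2 g14 (by omega) h
    · exact Reaches.sub (hC1 7 _ rfl) g21 g2 (by omega) h
  refine hsub _ _ _ (by simp) (by simp [e2]) (by simp [e14]) ?_
  by_cases hm1 : 0 < m
  · refine Reaches.mono (M := (20 * (3 * T.height + 2) + 2) + 1) ?_ (by omega)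
    refine Reaches.jumpLt_true (x := 0) (y := m) (hC1 8 _ rfl) (by simp [e20]) (by simp) hm1 ?_
    obtain ⟨k, hk, hres⟩ := RLTree.search_correct (okSym_mono false d) T m hm1 hmn
    obtain ⟨p, hp, hlast⟩ : ∃ p, RLTree.search (okSym false d) k T m 0 none = some p ∧
        IsLastOk (okSym false d) (T.str.take m) p.1 := by
      rcases hres with ⟨j, a, h1, h2⟩ | ⟨h1, h2⟩
      · exact ⟨_, h2, h1.isLastOk⟩
      · exact ⟨_, h2, isLastOk_zero h1⟩
    refine Reaches.trans (Reaches.mono (reaches_searchCode (z := root.len) (i := i) hC2 hS' k T m 0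
      none p _ hp T.self_mem_subterms hm1 hmn (by omega) ?_ (by simp [haddr]) (by simp) (by simp)
      (fun _ => by simp) (fun c o h => by simp at h)) (by omega)) ?_
    · simp [Env, e1, e2, e14, e15, e16, e17, e20]
    · rintro ⟨pc, reg', mem'⟩ ⟨rfl, rfl, g0, -, g⟩
      obtain ⟨k, hk, c', h1, h2, h3, h4⟩ := hend p.1 reg' g0 g.2.2.1 g.2.2.2.2.2.2.2.2.2
      exact ⟨k, hk, c', h1, h2, h3, p.1, hlast, h4⟩
  · refine Reaches.mono (M := 2 + 3) ?_ (by omega)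
    refine Reaches.jumpLt_false (x := 0) (y := m) (hC1 8 _ rfl) (by simp [e20]) (by simp) hm1 ?_
    refine Reaches.const (hC1 9 _ rfl) (by omega) ?_
    refine Reaches.jump (hC1 10 _ rfl) ?_
    obtain ⟨k, hk, c', h1, h2, h3, h4⟩ := hend 0 (Function.update (Function.update
      (Function.update (Function.update (Function.update (Function.update (Function.update
      (Function.update (Function.update reg 18 (if rev = true then 2 else 1)) 19
      (if rev = true then 1 else 2)) 5 0) 6 0) 3 (addr root)) 9 (addr root + 3)) 21 root.len) 4 m)
      0 0) (by simp) (by simp [e14]) (by simp)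
    refine ⟨k, hk, c', h1, h2, h3, 0, isLastOk_zero ?_, h4⟩
    have : m = 0 := by omega
    simp [this]

theorem RLTree.leaf_mem_subterms {t : RLTree} {a : ℕ} (h : a ∈ t.str) :
    leaf a ∈ t.subterms := by
  induction t with
  | leaf b =>
    simp only [str, List.mem_singleton] at h
    simp [subterms, h]
  | pair l r hl hr =>
    simp only [str, List.mem_append] at h
    simp only [subterms, Finset.mem_insert, Finset.mem_union]
    exact Or.inr (h.imp hl hr)
  | pow t k ih =>
    simp only [str, List.mem_flatten, List.mem_replicate] at h
    obtain ⟨x, ⟨-, rfl⟩, h⟩ := h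
    exact Finset.mem_insert_of_mem (ih h)

theorem reaches_accessCode {base i : ℕ} {reg : ℕ → ℕ}
    (hC : CodeAt P base (accessCode base)) (hS : Stored mem W 1 2 root addr)
    (h0 : mem[0]? = some (addr root)) (hi1 : 1 ≤ i) (hi : i ≤ root.len)
    (h5 : reg 5 = 0) (h6 : reg 6 = 0)
    (hE : Env (reg 1) i (reg 21) (reg 18) (reg 19) reg) :
    Reaches W P (60 * root.height + 45) ⟨base, reg, mem⟩ fun c => c.pc = base + 49 ∧
      c.mem = mem ∧ Env (symbol root.str i) i (c.reg 21) (c.reg 18) (c.reg 19) c.reg := by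
  have hC1 := hC.left
  have hC2 := hC.right.left
  have hC3 := hC.right.right
  simp only [List.length_cons, List.length_nil, zero_add, Nat.reduceAdd] at hC2 hC3
  replace hC3 : CodeAt P (base + 48) [.copy 1 8] := hC3
  obtain ⟨-, e2, e14, e15, e16, e17, -, -, e20, -⟩ := id hE
  have hlen := hS.len root root.self_mem_subterms
  have hlenW := hS.lt_of_getElem? hlen
  have hpos := hS.addr_pos root
  have hrootW : root.len < 2 ^ W := hS.word_lt _ (List.mem_of_getElem? hlen)
  obtain ⟨k, hk, hres⟩ := RLTree.search_correct (okSym_mono true (reg 1)) root i hi1 hi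
  have hilen : i - 1 < root.str.length := by rw [RLTree.length_str]; omega
  have hsym : root.str[i - 1]? = some (symbol root.str i) := by
    rw [symbol, List.getD_eq_getElem?_getD, List.getElem?_eq_getElem hilen, Option.getD_some]
  have hsearch : RLTree.search (okSym true (reg 1)) k root i 0 none =
      some (i, symbol root.str i) := by
    rcases hres with ⟨j, a, ⟨x, y, hxy, hj, -, hy⟩, h2⟩ | ⟨h1, -⟩
    · have hy0 : y = [] := List.eq_nil_iff_forall_not_mem.2 fun b hb => by
        simpa [okSym] using hy b hb
      subst hy0
      have hl := congrArg List.length hxy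
      simp only [List.length_take, RLTree.length_str, List.length_append, List.length_cons,
        List.length_nil] at hl
      have hji : j = i := by omega
      have ha : (root.str.take i)[i - 1]? = some a := by
        rw [hxy, show i - 1 = x.length by omega]; simp
      rw [List.getElem?_take_of_lt (by omega), hsym] at ha
      rw [h2, hji, Option.some.inj ha]
    · have := h1 (symbol root.str i) (List.mem_of_getElem? (i := i - 1)
        (by rw [List.getElem?_take_of_lt (by omega), hsym]))
      simp [okSym] at this
  refine Reaches.mono (M := (20 * (3 * root.height + 2) + 1) + 4) ?_ (by omega)
  refine Reaches.const (hC1 0 _ rfl) (by omega) ?_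
  refine Reaches.const (hC1 1 _ rfl) (by omega) ?_
  refine Reaches.load (x := 0) (hC1 2 _ rfl) (by simp [e20]) h0 hS.word_lt ?_
  refine Reaches.copy (v := i) (hC1 3 _ rfl) (by simp [e2]) (by omega) ?_
  refine Reaches.trans (Reaches.mono (reaches_searchCode (z := reg 21) (i := i) (d := reg 1) hC2 hS
    k root i 0 none _ _ hsearch root.self_mem_subterms hi1 hi (by omega) ?_ (by simp) (by simp)
    (by simp [h5]) (fun _ => by simp [h6]) (fun c o h => by simp at h)) (by omega)) ?_
  · simp [Env, e2, e14, e15, e16, e17, e20]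
  · rintro ⟨pc, reg', mem'⟩ ⟨rfl, rfl, -, g8, -, g2, g14, g15, g16, g17, -, -, g20, -⟩
    refine Reaches.copy (hC3 0 _ rfl) (g8 (by simp; omega))
      (hS.word_lt _ ?_) (Reaches.refl ⟨rfl, rfl, ?_⟩)
    · exact List.mem_of_getElem? (hS.minSym _ (RLTree.leaf_mem_subterms
        (List.mem_of_getElem? hsym)))
    · simp only [] at g2 g14 g15 g16 g17 g20
      simp [Env, g2, g14, g15, g16, g17, g20]

end

/-! ### Answers to the queries -/

theorem symbol_of_getElem? {w : List ℕ} {j a : ℕ} (h : w[j - 1]? = some a) : symbol w j = a := by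
  rw [symbol, List.getD_eq_getElem?_getD, h, Option.getD_some]

theorem getElem?_of_symbol {w : List ℕ} {j : ℕ} (h1 : 1 ≤ j) (h2 : j ≤ w.length) :
    w[j - 1]? = some (symbol w j) := by
  rw [symbol, List.getD_eq_getElem?_getD, List.getElem?_eq_getElem (by omega), Option.getD_some]

theorem psvBelow_eq {w : List ℕ} {i d r : ℕ} (hi : i ≤ w.length + 1)
    (h : IsLastOk (okSym false d) (w.take (i - 1)) r) : psvBelow w i d = r := by
  refine IsGreatest.csSup_eq ⟨?_, ?_⟩
  · rcases h.1 with h0 | ⟨h1, a, ha, hok⟩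
    · exact Or.inr h0
    · have hlen := (List.getElem?_eq_some_iff.1 ha).1
      rw [List.length_take] at hlen
      rw [List.getElem?_take_of_lt (by omega)] at ha
      refine Or.inl ⟨⟨h1, by omega⟩, by omega, ?_⟩
      rw [symbol_of_getElem? ha]
      simpa [okSym] using hok
  · rintro j (⟨⟨hj1, hj2⟩, hj3, hj4⟩ | rfl)
    · by_contra hlt
      have := h.2 j (by omega) (symbol w j)
        (by rw [List.getElem?_take_of_lt (by omega), getElem?_of_symbol hj1 hj2])
      simp only [okSym, Bool.false_or, decide_eq_false_iff_not] at this
      exact this hj4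
    · exact Nat.zero_le _

theorem nsvBelow_eq {w : List ℕ} {i d r : ℕ}
    (h : IsLastOk (okSym false d) (w.reverse.take (w.length - i)) r) :
    nsvBelow w i d = w.length + 1 - r := by
  refine IsLeast.csInf_eq ⟨?_, ?_⟩
  · rcases h.1 with h0 | ⟨h1, a, ha, hok⟩
    · exact Or.inr (by rw [h0]; rfl)
    · have hlen := (List.getElem?_eq_some_iff.1 ha).1
      rw [List.length_take, List.length_reverse] at hlen
      rw [List.getElem?_take_of_lt (by omega), List.getElem?_reverse (by omega),
        show w.length - 1 - (r - 1) = w.length + 1 - r - 1 by omega] at ha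
      refine Or.inl ⟨⟨by omega, by omega⟩, by omega, ?_⟩
      rw [symbol_of_getElem? ha]
      simpa [okSym] using hok
  · rintro j (⟨⟨hj1, hj2⟩, hj3, hj4⟩ | hj)
    · by_contra hlt
      have := h.2 (w.length + 1 - j) (by omega) (symbol w j) (by
        rw [List.getElem?_take_of_lt (by omega), List.getElem?_reverse (by omega),
          show w.length - 1 - (w.length + 1 - j - 1) = j - 1 by omega,
          getElem?_of_symbol hj1 hj2])
      simp only [okSym, Bool.false_or, decide_eq_false_iff_not] at this
      exact this hj4
    · rw [Set.mem_singleton_iff] at hj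
      omega

section

variable {W : ℕ} {mem : List ℕ} {root : RLTree} {addr : RLTree → ℕ}

theorem reaches_initCode {P : List Instr} {N i : ℕ} {reg : ℕ → ℕ} {Q : Config → Prop}
    (hC : CodeAt P 0 initCode) (hW : 4 < 2 ^ W) (hi : i < 2 ^ W) (h0 : reg 0 = i)
    (h20 : reg 20 = 0)
    (h : ∀ reg', Env (reg 1) i (reg' 21) (reg' 18) (reg' 19) reg' → reg' 5 = reg 5 →
      reg' 6 = reg 6 → Reaches W P N ⟨5, reg', mem⟩ Q) :
    Reaches W P (N + 5) ⟨0, reg, mem⟩ Q := by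
  refine Reaches.copy (hC 0 _ rfl) h0 hi ?_
  refine Reaches.const (hC 1 _ rfl) (by omega) ?_
  refine Reaches.const (hC 2 _ rfl) (by omega) ?_
  refine Reaches.const (hC 3 _ rfl) (by omega) ?_
  refine Reaches.const (hC 4 _ rfl) (by omega) ?_
  exact h _ (by simp [Env, h20]) (by simp) (by simp)

theorem answers_of_reaches {P : List Instr} {args : List ℕ} {T out : ℕ}
    (h : Reaches W P T ⟨0, fun r => args.getD r 0, mem⟩ fun c =>
      P[c.pc]? = some .halt ∧ c.mem = mem ∧ c.reg 0 = out) :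
    Answers W P mem args T out := by
  obtain ⟨k, hk, c, h1, h2, h3, h4⟩ := h
  exact ⟨k, hk, c, h1, h2, h4, h3⟩

theorem eq_below {rev : Bool} {w : List ℕ} {i d r out : ℕ} (hi : i ≤ w.length + 1)
    (h : IsLastOk (okSym false d)
      (if rev then w.reverse.take (w.length - i) else w.take (i - 1)) r)
    (ho : out = if rev then w.length + 1 - r else r) :
    out = if rev then nsvBelow w i d else psvBelow w i d := by
  cases rev
  · rw [ho]; exact (psvBelow_eq hi h).symm
  · rw [ho]; exact (nsvBelow_eq h).symm

theorem answers_belowProg (rev : Bool) {i d : ℕ} (hS : Stored mem W 1 2 root addr)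
    (h0 : mem[0]? = some (addr root)) (hn : root.len + 1 < 2 ^ W) (hW : 4 < 2 ^ W)
    (hi : i ≤ root.len + 1) :
    Answers W (belowProg rev) mem [i, d] (60 * root.height + 60)
      (if rev then nsvBelow root.str i d else psvBelow root.str i d) := by
  refine answers_of_reaches ?_
  have hC := codeAt_self (belowProg rev)
  refine reaches_initCode (N := 60 * root.height + 55) (i := i) hC.left hW (by omega)
    (by simp) (by simp) ?_
  intro reg' hE _ _
  refine (reaches_mainCode (rev := rev) (base := 5) (d := d) (i := i)
    hC.right hS h0 hn hi (by simpa using hE)).trans (N := 0) ?_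
  rintro c ⟨h1, h2, r, h3, h4⟩
  rw [← RLTree.length_str] at h3 h4 hi
  exact Reaches.refl ⟨h1, h2, eq_below hi h3 h4⟩

theorem answers_symbolProg (rev : Bool) {i : ℕ} (hS : Stored mem W 1 2 root addr)
    (h0 : mem[0]? = some (addr root)) (hn : root.len + 1 < 2 ^ W) (hW : 4 < 2 ^ W)
    (hi1 : 1 ≤ i) (hi : i ≤ root.len) :
    Answers W (symbolProg rev) mem [i] (120 * root.height + 105)
      (if rev then nsv root.str i else psv root.str i) := by
  refine answers_of_reaches ?_
  have hC := codeAt_self (symbolProg rev)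
  refine Reaches.mono (M := ((60 * root.height + 45) + ((60 * root.height + 55) + 0)) + 5) ?_
    (by omega)
  refine reaches_initCode (i := i) hC.left hW (by omega) (by simp) (by simp) ?_
  intro reg' hE h5 h6
  refine (reaches_accessCode (base := 5) (i := i) hC.right.left hS h0 hi1 hi (by simpa using h5)
    (by simpa using h6) (by obtain ⟨-, h⟩ := hE; exact ⟨rfl, h⟩)).trans ?_
  rintro ⟨pc, reg'', mem'⟩ ⟨rfl, rfl, hE''⟩
  refine (reaches_mainCode (rev := rev) (base := 54) (i := i)
    hC.right.right hS h0 hn (by omega) hE'').trans ?_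
  rintro c ⟨h1, h2, r, h3, h4⟩
  rw [← RLTree.length_str] at h3 h4 hi
  exact Reaches.refl ⟨h1, h2, eq_below (by omega) h3 h4⟩

end

/-! ### Memory layout -/

namespace RLTree

/-- The address of a subtree: records of five words follow the root pointer at address `0`. -/
def address (L : List RLTree) (t : RLTree) : ℕ := 5 * L.idxOf t + 1

/-- The record of a subtree. -/
def record (L : List RLTree) (t : RLTree) : List ℕ :=
  match t with
  | leaf a => [a, 0, 0, 1, 0]
  | pair l r => [(pair l r).minSym, address L l, address L r, (pair l r).len, 1]
  | pow s k => [(pow s k).minSym, address L s, address L s, (pow s k).len, 2]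

theorem length_record (L : List RLTree) (t : RLTree) : (record L t).length = 5 := by
  cases t <;> rfl

/-- The memory image of a list of subtrees of `t`. -/
def layout (L : List RLTree) (t : RLTree) : List ℕ := address L t :: L.flatMap (record L)

theorem length_layout (L : List RLTree) (t : RLTree) : (layout L t).length = 5 * L.length + 1 := by
  simp [layout, List.length_flatMap, length_record, mul_comm]

theorem getElem?_flatMap_of_length {α β : Type*} [BEq α] [LawfulBEq α] (f : α → List β) (n : ℕ)
    (hf : ∀ x, (f x).length = n) {l : List α} {x : α} (hx : x ∈ l) {j : ℕ} (hj : j < n) :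
    (l.flatMap f)[n * l.idxOf x + j]? = (f x)[j]? := by
  induction l with
  | nil => simp at hx
  | cons y l ih =>
    rw [List.flatMap_cons]
    by_cases hxy : y = x
    · subst hxy
      rw [List.idxOf_cons_self, mul_zero, zero_add,
        List.getElem?_append_left (by rw [hf]; exact hj)]
    · rw [List.idxOf_cons_ne _ hxy, List.getElem?_append_right (by rw [hf, Nat.mul_succ]; omega),
        hf, ← ih ((List.mem_cons.1 hx).resolve_left (Ne.symm hxy))]
      congr 1
      rw [Nat.mul_succ]; omega

theorem getElem?_layout (L : List RLTree) (t : RLTree) {s : RLTree} (hs : s ∈ L) {j : ℕ}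
    (hj : j < 5) : (layout L t)[address L s + j]? = (record L s)[j]? := by
  rw [layout, show address L s + j = (5 * L.idxOf s + j) + 1 by rw [address]; ring,
    List.getElem?_cons_succ]
  exact getElem?_flatMap_of_length _ 5 (length_record L) hs hj

end RLTree

open RLTree in
theorem exists_stored (t : RLTree) (W : ℕ) (hcard : 5 * t.subterms.card + 1 < 2 ^ W)
    (hlen : t.len < 2 ^ W) (hsym : ∀ a ∈ t.str, a < 2 ^ W) :
    ∃ (mem : List ℕ) (addr : RLTree → ℕ), mem.length = 5 * t.subterms.card + 1 ∧
      mem[0]? = some (addr t) ∧ Stored mem W 1 2 t addr := by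
  set L := t.subterms.toList with hL
  have hLlen : L.length = t.subterms.card := Finset.length_toList _
  have hmem : ∀ {s}, s ∈ t.subterms → s ∈ L := fun h => Finset.mem_toList.2 h
  have haddr : ∀ s, address L s < 2 ^ W := fun s => by
    have : L.idxOf s ≤ L.length := List.idxOf_le_length
    rw [address]; omega
  have hcard1 : 0 < t.subterms.card := Finset.card_pos.2 ⟨t, t.self_mem_subterms⟩
  refine ⟨layout L t, address L, by rw [length_layout, hLlen], by simp [layout], ?_⟩
  refine ⟨?_, by rw [length_layout]; omega, fun s => Nat.succ_pos _, ?_, ?_, ?_, ?_, ?_⟩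
  · intro x hx
    rw [layout, List.mem_cons, List.mem_flatMap] at hx
    rcases hx with rfl | ⟨s, hs, hx⟩
    · exact haddr t
    · rw [hL, Finset.mem_toList] at hs
      have h1 : s.minSym < 2 ^ W :=
        hsym _ (str_subset_of_mem_subterms hs s.minSym_mem_str)
      have h2 : s.len < 2 ^ W := (len_le_of_mem_subterms hs).trans_lt hlen
      cases s with
      | leaf a =>
        simp only [record, List.mem_cons, List.not_mem_nil, or_false] at hx
        simp only [minSym] at h1
        rcases hx with rfl | rfl | rfl | rfl | rfl <;> omega
      | pair l r =>
        simp only [record, List.mem_cons, List.not_mem_nil, or_false] at hx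
        rcases hx with rfl | rfl | rfl | rfl | rfl
        exacts [h1, haddr _, haddr _, h2, by omega]
      | pow l r =>
        simp only [record, List.mem_cons, List.not_mem_nil, or_false] at hx
        rcases hx with rfl | rfl | rfl | rfl | rfl
        exacts [h1, haddr _, haddr _, h2, by omega]
  · intro s hs
    have := getElem?_layout L t (hmem hs) (j := 0) (by norm_num)
    rw [add_zero] at this
    rw [this]
    cases s <;> rfl
  · intro s hs
    rw [getElem?_layout L t (hmem hs) (by norm_num)]
    cases s <;> rfl
  · intro a hs
    rw [getElem?_layout L t (hmem hs) (by norm_num)]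
    rfl
  · intro l r hs
    rw [getElem?_layout L t (hmem hs) (by norm_num), getElem?_layout L t (hmem hs) (by norm_num),
      getElem?_layout L t (hmem hs) (by norm_num)]
    exact ⟨rfl, rfl, rfl⟩
  · intro s k hs
    rw [getElem?_layout L t (hmem hs) (by norm_num), getElem?_layout L t (hmem hs) (by norm_num),
      getElem?_layout L t (hmem hs) (by norm_num)]
    exact ⟨rfl, rfl, rfl⟩

/-! ### The smallest grammar -/

/-- Every nonempty string has a grammar with one terminal rule for each of its positions. -/
theorem exists_grammar {α : Type} (w : List α) (hw : w ≠ []) :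
    ∃ G : RLSLP α, G.string = w ∧ G.size ≤ 2 * w.length := by
  have hpos := List.length_pos_iff.2 hw
  by_cases h1 : w.length = 1
  · obtain ⟨a, rfl⟩ := List.length_eq_one_iff.1 h1
    refine ⟨⟨1, Nat.one_pos, fun _ => .terminal a⟩, ?_, ?_⟩
    · rw [RLSLP.string, RLSLP.exp]
    · simp [RLSLP.size, Rule.size]
  · let G : RLSLP α := ⟨w.length + 1, Nat.succ_pos _, fun A =>
      if h : A.val < w.length then .terminal w[A.val]
      else .concat (List.finRange A.val) (by rw [List.length_finRange]; omega)⟩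
    refine ⟨G, ?_, ?_⟩
    · have hterm : ∀ (A : ℕ) (hA : A < G.numVars) (h : A < w.length), G.exp A hA = [w[A]] := by
        intro A hA h
        rw [RLSLP.exp]
        simp [G, h]
      have hroot : G.exp w.length (Nat.lt_succ_self _) = w := by
        rw [RLSLP.exp]
        simp only [G, lt_irrefl, dite_false]
        have : ∀ B : Fin w.length, G.exp B.val (B.isLt.trans (Nat.lt_succ_self _)) = [w[B]] :=
          fun B => hterm _ _ B.isLt
        refine (List.flatMap_congr fun B _ => this B).trans ?_
        rw [← List.map_eq_flatMap]
        exact List.map_getElem_finRange w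
      exact hroot
    · rw [RLSLP.size]
      show ∑ A : Fin (w.length + 1), (G.rule A).size ≤ _
      rw [Fin.sum_univ_castSucc]
      simp [G, Rule.size]
      omega

/-- A smallest grammar exists. -/
theorem exists_smallest_grammar {α : Type} (w : List α) (hw : w ≠ []) :
    ∃ G : RLSLP α, G.string = w ∧ G.size = gRL w ∧ gRL w ≤ 2 * w.length := by
  obtain ⟨G, h1, h2⟩ := exists_grammar w hw
  have hmem : G.size ∈ {s : ℕ | ∃ G : RLSLP α, G.string = w ∧ G.size = s} := ⟨G, h1, rfl⟩
  obtain ⟨G', h3, h4⟩ := Nat.sInf_mem ⟨_, hmem⟩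
  exact ⟨G', h3, h4, (Nat.sInf_le hmem).trans h2⟩

end RunLength

theorem theorem4 :
    ∃ (C : ℕ) (progPsv progNsv progPsvBelow progNsvBelow : List RunLength.Instr),
      ∀ (w : List ℕ) (W : ℕ), w ≠ [] →
        C * (w.length + 2) ≤ 2 ^ W → (∀ a ∈ w, a < 2 ^ W) →
        ∃ index : List ℕ,
          index.length ≤ C * RunLength.gRL w ∧
          (∀ x ∈ index, x < 2 ^ W) ∧
          (∀ i : ℕ, 1 ≤ i → i ≤ w.length →
            RunLength.Answers W progPsv index [i]
              (C * (Nat.log 2 w.length + 1)) (RunLength.psv w i) ∧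
            RunLength.Answers W progNsv index [i]
              (C * (Nat.log 2 w.length + 1)) (RunLength.nsv w i)) ∧
          (∀ i d : ℕ, i ≤ w.length + 1 → d < 2 ^ W →
            RunLength.Answers W progPsvBelow index [i, d]
              (C * (Nat.log 2 w.length + 1)) (RunLength.psvBelow w i d) ∧
            RunLength.Answers W progNsvBelow index [i, d]
              (C * (Nat.log 2 w.length + 1)) (RunLength.nsvBelow w i d)) := by
  refine ⟨3000, RunLength.symbolProg false, RunLength.symbolProg true,
    RunLength.belowProg false, RunLength.belowProg true, fun w W hw hW hsym => ?_⟩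
  obtain ⟨G, hG, hsize, hg⟩ := RunLength.exists_smallest_grammar w hw
  obtain ⟨t, ht, hheight, hcard⟩ := G.exists_balanced_tree
  rw [hG] at ht hheight
  rw [hsize] at hcard
  have hlen : t.len = w.length := by rw [← RunLength.RLTree.length_str, ht]
  have hcard1 : 0 < t.subterms.card := Finset.card_pos.2 ⟨t, t.self_mem_subterms⟩
  subst ht
  obtain ⟨mem, addr, h1, h2, hS⟩ := RunLength.exists_stored t W (by omega) (by omega) hsym
  have mono : ∀ {P args T out}, RunLength.Answers W P mem args T out →
      T ≤ 3000 * (Nat.log 2 t.str.length + 1) →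
      RunLength.Answers W P mem args (3000 * (Nat.log 2 t.str.length + 1)) out := by
    rintro P args T out ⟨k, hk, h⟩ hT
    exact ⟨k, hk.trans hT, h⟩
  refine ⟨mem, by omega, hS.word_lt, fun i hi1 hi => ?_, fun i d hi _ => ?_⟩
  · rw [← hlen] at hi
    exact ⟨mono (RunLength.answers_symbolProg false hS h2 (by omega) (by omega) hi1 hi) (by omega),
      mono (RunLength.answers_symbolProg true hS h2 (by omega) (by omega) hi1 hi) (by omega)⟩
  · rw [← hlen] at hi
    exact ⟨mono (RunLength.answers_belowProg false hS h2 (by omega) (by omega) hi) (by omega),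
      mono (RunLength.answers_belowProg true hS h2 (by omega) (by omega) hi) (by omega)⟩
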